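/- There is an absolute constant $C$ such that the following holds. Let $p\ge 3$ be a prime and put $\alpha_p = 1-\prod_{i=1}^{\infty}(1-p^{-i})$. Then there is $\delta_p>0$, depending only on $p$, such that for every probability distribution $\mu$ on $\mathbb F_p$ supported on more than one value the following is true. For each $n$, let $A_n\in\mathbb F_p^{n\times n}$ be a random matrix with independent $\mu$-distributed entries, and let $\operatorname{per}(A_n)=\sum_{\pi\in S_n}\prod_{i=1}^n (A_n)_{i,\pi(i)}$ be its permanent. Then for every $z\in\mathbb F_p$, $$\limsup_{n\to\infty}\Pr[\operatorname{per}(A_n)=z]\le \alpha_p-\delta_p$$ and $$\frac1p-\frac{C}{p^3}\le \liminf_{n\to\infty}\Pr[\operatorname{per}(A_n)=z]\le \limsup_{n\to\infty}\Pr[\operatorname{per}(A_n)=z]\le \frac1p+\frac{C}{p^3}.$$ -/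

import Mathlib

open MeasureTheory ProbabilityTheory Filter

/-- The limiting singularity probability of a uniformly random square matrix over a field with
`q` elements: `α_q = 1 - ∏_{i = 1}^∞ (1 - q^{-i})`. -/
noncomputable def alphaConst (q : ℕ) : ℝ :=
  1 - ∏' i : ℕ, (1 - ((q : ℝ) ^ (i + 1))⁻¹)

/-- The infinite product in `alphaConst` converges. -/
theorem alphaConst_multipliable (q : ℕ) (hq : 2 ≤ q) :
    Multipliable (fun i : ℕ => 1 - ((q : ℝ) ^ (i + 1))⁻¹) := by
  have hq' : (1 : ℝ) < q := by exact_mod_cast (by omega : 1 < q)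
  have hs : Summable (fun i : ℕ => ‖-((q : ℝ) ^ (i + 1))⁻¹‖) := by
    have h := (summable_geometric_of_lt_one (inv_nonneg.mpr (by positivity))
      (inv_lt_one_of_one_lt₀ hq'))
    have h1 := (summable_nat_add_iff 1).mpr h
    refine h1.congr fun i => ?_
    rw [norm_neg, Real.norm_of_nonneg (by positivity), inv_pow]
  simpa [sub_eq_add_neg] using multipliable_one_add_of_summable hs

/-- `A` is a random `n × n` matrix over `F_p`, defined on a probability space with measure `P`,
whose entries are independent and all have distribution `μ`. -/
structure IsIIDMatrix {Ω : Type*} [MeasurableSpace Ω] {p n : ℕ}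
    (A : Ω → Matrix (Fin n) (Fin n) (ZMod p)) (μ : PMF (ZMod p)) (P : Measure Ω) : Prop where
  indep : iIndepFun (fun (ij : Fin n × Fin n) (ω : Ω) => A ω ij.1 ij.2) P
  law : ∀ i j, HasLaw (fun ω => A ω i j) μ.toMeasure P

/-! The rows are revealed one at a time. The permanent is the result of contracting the square-free
form $x_1\cdots x_n$ successively with all rows (`low`, `lows`, `topForm`). After $n-d$ rows a form
of degree $d$ remains, whose coefficients are permanents of minors on complementary columns. The
form is followed through the property `Robust`: arbitrarily many disjoint $d$-sets carry a nonzero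
coefficient. If the last linear form is robust, Fourier analysis makes the permanent nearly uniform
(`RobustBound.permanent`), so everything reduces to bounding below the probability of robustness in
degree 1.

In a large fixed degree $D$, robustness is likely: by `pr_lows_eq_zero_le` a set of $2D$ columns
almost always contains a nonzero coefficient, and many disjoint such sets are available
(`exists_robustBound`). Passing from degree $d+1$ to $d$ costs a factor $1-p^{-(d+1)}$, because the
$d+1$ contractions belonging to a block are linear functionals of the new row which are independent
on that block (`exists_le_pr_robust_low`). These factors alone would give only the upper bound
$\alpha_p$.

The gain comes from `RobustTriple`: a $(d+2)$-set with three nonzero coefficients of degree $d+1$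
yields $d+2$ independent functionals if $p$ is odd, so the failure probability drops to $p^{-(d+2)}$
(`exists_le_pr_robust_low_of_robustTriple`). Markov's inequality for the number of vanishing
functionals shows that this configuration is common (`exists_le_pr_robustTriple_low`). Using the
gain in degree 3 separates the limit from $\alpha_p$ for every odd $p$; using it in degree 2 removes
the loss of order $p^{-2}$ and leaves $O(p^{-3})$.

Blocks are disjoint, but their functionals may interact outside their own blocks. This is handled by
a dichotomy: functionals of small support interact with few blocks, so an independent subfamily can
be chosen; functionals of large support are nearly uniform. -/

/-! ### Finite probability: expectations, product weights, resampling of coordinates. -/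

section FiniteWeights
open scoped Classical
open Finset

/-- A probability weight on a finite type. -/
structure IsWeight {α : Type*} [Fintype α] (w : α → ℝ) : Prop where
  nonneg : ∀ x, 0 ≤ w x
  sum_eq_one : ∑ x, w x = 1

/-- Expectation with respect to a weight on a finite type. -/
noncomputable def ev {α : Type*} [Fintype α] (w : α → ℝ) (f : α → ℝ) : ℝ := ∑ x, w x * f x

/-- Probability of an event with respect to a weight on a finite type. -/
noncomputable def pr {α : Type*} [Fintype α] (w : α → ℝ) (B : α → Prop) : ℝ :=
  ev w (fun x => if B x then 1 else 0)

/-- The product weight. -/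
def wt {ι α : Type*} [Fintype ι] (w : α → ℝ) (x : ι → α) : ℝ := ∏ i, w (x i)

/-- The number of elements of a finite set with a given property. -/
noncomputable def cnt {κ : Type*} (s : Finset κ) (P : κ → Prop) : ℕ := (s.filter P).card

theorem cnt_eq {κ : Type*} (s : Finset κ) (P : κ → Prop) [DecidablePred P] :
    cnt s P = (s.filter P).card := by
  unfold cnt; congr

theorem cnt_le_cnt {κ : Type*} {s t : Finset κ} {P Q : κ → Prop} (hst : s ⊆ t)
    (h : ∀ i ∈ s, P i → Q i) : cnt s P ≤ cnt t Q :=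
  card_le_card fun i hi => by
    rw [mem_filter] at hi ⊢
    exact ⟨hst hi.1, h i hi.1 hi.2⟩

theorem cnt_le_cnt_of_imp {κ : Type*} {s t : Finset κ} {P Q : κ → Prop}
    (h : ∀ i ∈ s, P i → i ∈ t ∧ Q i) : cnt s P ≤ cnt t Q :=
  card_le_card fun i hi => by
    rw [mem_filter] at hi ⊢
    exact h i hi.1 hi.2

theorem cnt_le_card_of_imp {κ : Type*} {s t : Finset κ} {P : κ → Prop}
    (h : ∀ i ∈ s, P i → i ∈ t) : cnt s P ≤ t.card :=
  card_le_card fun i hi => by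
    rw [mem_filter] at hi
    exact h i hi.1 hi.2

theorem cnt_le_card {κ : Type*} (s : Finset κ) (P : κ → Prop) : cnt s P ≤ s.card :=
  card_filter_le _ _

/-- Counting along an injection. -/
theorem cnt_le_cnt_of_injective {κ κ' : Type*} [Fintype κ] [Fintype κ'] {f : κ → κ'}
    (hf : Function.Injective f) {P : κ → Prop} {Q : κ' → Prop} (h : ∀ i, P i → Q (f i)) :
    cnt univ P ≤ cnt univ Q := by
  rw [cnt, cnt, ← card_map ⟨f, hf⟩]
  refine card_le_card fun i hi => ?_
  obtain ⟨x, hx, rfl⟩ := mem_map.1 hi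
  exact mem_filter.2 ⟨mem_univ _, h x (mem_filter.1 hx).2⟩

variable {α : Type*} [Fintype α] {w : α → ℝ}

theorem ev_mono (hw : IsWeight w) {f g : α → ℝ} (h : ∀ x, f x ≤ g x) : ev w f ≤ ev w g :=
  sum_le_sum fun x _ => mul_le_mul_of_nonneg_left (h x) (hw.nonneg x)

theorem ev_const (hw : IsWeight w) (c : ℝ) : ev w (fun _ => c) = c := by
  rw [ev, ← sum_mul, hw.sum_eq_one, one_mul]

theorem ev_add (f g : α → ℝ) : ev w (fun x => f x + g x) = ev w f + ev w g := by
  simp [ev, mul_add, sum_add_distrib]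

theorem ev_sub (f g : α → ℝ) : ev w (fun x => f x - g x) = ev w f - ev w g := by
  simp [ev, mul_sub, sum_sub_distrib]

theorem ev_const_mul (c : ℝ) (f : α → ℝ) : ev w (fun x => c * f x) = c * ev w f := by
  simp only [ev, mul_sum]; exact sum_congr rfl fun x _ => by ring

theorem ev_sum {κ : Type*} (s : Finset κ) (f : κ → α → ℝ) :
    ev w (fun x => ∑ i ∈ s, f i x) = ∑ i ∈ s, ev w (f i) := by
  simp only [ev, mul_sum]; exact sum_comm

theorem pr_nonneg (hw : IsWeight w) (B : α → Prop) : 0 ≤ pr w B :=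
  sum_nonneg fun x _ => mul_nonneg (hw.nonneg x) (by dsimp only; split_ifs <;> norm_num)

theorem pr_le_of_imp (hw : IsWeight w) {B C : α → Prop} (h : ∀ x, B x → C x) : pr w B ≤ pr w C :=
  ev_mono hw fun x => by
    by_cases hB : B x
    · simp [hB, h x hB]
    · simp only [hB, if_false]; split_ifs <;> norm_num

theorem pr_congr {B C : α → Prop} (h : ∀ x, B x ↔ C x) : pr w B = pr w C := by
  simp only [pr, h]

theorem pr_not (hw : IsWeight w) (B : α → Prop) : pr w (fun x => ¬ B x) = 1 - pr w B := by
  have h1 := ev_const hw 1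
  rw [pr, pr, ← h1, ← ev_sub]
  congr 1; ext x; rw [h1]; by_cases h : B x <;> simp [h]

theorem pr_le_one (hw : IsWeight w) (B : α → Prop) : pr w B ≤ 1 := by
  have := pr_nonneg hw (fun x => ¬ B x)
  rw [pr_not hw] at this; linarith

theorem pr_exists_le (hw : IsWeight w) {κ : Type*} (s : Finset κ) (B : κ → α → Prop) :
    pr w (fun x => ∃ i ∈ s, B i x) ≤ ∑ i ∈ s, pr w (B i) := by
  simp only [pr]
  rw [← ev_sum]
  refine ev_mono hw fun x => ?_
  split_ifs with h
  · obtain ⟨i, hi, hB⟩ := h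
    refine le_trans ?_ (single_le_sum (f := fun i => if B i x then (1:ℝ) else 0)
      (fun j _ => by split_ifs <;> norm_num) hi)
    simp [hB]
  · exact sum_nonneg fun j _ => by split_ifs <;> norm_num

theorem ev_card_filter {κ : Type*} (s : Finset κ) (B : κ → α → Prop) :
    ev w (fun x => (cnt s (fun i => B i x) : ℝ)) = ∑ i ∈ s, pr w (B i) := by
  simp only [pr]
  rw [← ev_sum]
  congr 1; ext x; simp [cnt]

/-- Markov's inequality for the number of events that occur. -/
theorem mul_pr_le_card_filter (hw : IsWeight w) {κ : Type*} (s : Finset κ) (B : κ → α → Prop)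
    (t : ℝ) : t * pr w (fun x => t ≤ (cnt s (fun i => B i x) : ℝ)) ≤
      ∑ i ∈ s, pr w (B i) := by
  rw [← ev_card_filter, pr, ← ev_const_mul]
  refine ev_mono hw fun x => ?_
  split_ifs with h
  · simpa using h
  · simp

/-- If many events are each likely, then it is likely that many of them occur. -/
theorem le_pr_card_filter (hw : IsWeight w) {κ : Type*} (s : Finset κ) (hs : s.Nonempty)
    (B : κ → α → Prop) (c : ℝ) (L : ℕ) (h : ∀ i ∈ s, c ≤ pr w (B i)) :
    c - L / s.card ≤ pr w (fun x => L ≤ cnt s (fun i => B i x)) := by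
  have hpos : (0 : ℝ) < s.card := by exact_mod_cast hs.card_pos
  have h1 : s.card * c ≤ ∑ i ∈ s, pr w (B i) := by
    rw [← nsmul_eq_mul]; exact card_nsmul_le_sum _ _ _ h
  rw [← ev_card_filter] at h1
  have h2 : ev w (fun x => (cnt s (fun i => B i x) : ℝ)) ≤
      s.card * pr w (fun x => L ≤ cnt s (fun i => B i x)) + L := by
    rw [pr, ← ev_const_mul, ← ev_const hw (L : ℝ), ← ev_add]
    refine ev_mono hw fun x => ?_
    split_ifs with hx
    · have : (cnt s (fun i => B i x) : ℝ) ≤ s.card := by exact_mod_cast cnt_le_card _ _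
      have : (0:ℝ) ≤ L := by positivity
      linarith
    · have : (cnt s (fun i => B i x) : ℝ) ≤ L := by exact_mod_cast (not_le.mp hx).le
      linarith
  rw [sub_le_iff_le_add, ← mul_le_mul_iff_right₀ hpos, mul_add, mul_div_cancel₀ _ hpos.ne']
  linarith

theorem isWeight_wt {ι : Type*} [Fintype ι] [DecidableEq ι] (hw : IsWeight w) :
    IsWeight (wt (ι := ι) w) where
  nonneg x := prod_nonneg fun i _ => hw.nonneg _
  sum_eq_one := by
    have := Fintype.prod_sum (fun (_ : ι) (a : α) => w a)
    simp only [wt]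
    rw [← this]; simp [hw.sum_eq_one]

theorem ev_equiv {β : Type*} [Fintype β] {v : β → ℝ} (e : α ≃ β) (h : ∀ x, w x = v (e x))
    (f : β → ℝ) : ev w (fun x => f (e x)) = ev v f := by
  simp only [ev, h]; exact e.sum_comp fun y => v y * f y

theorem pr_equiv {β : Type*} [Fintype β] {v : β → ℝ} (e : α ≃ β) (h : ∀ x, w x = v (e x))
    (B : β → Prop) : pr w (fun x => B (e x)) = pr v B :=
  ev_equiv e h fun y => if B y then 1 else 0

theorem ev_cons {k : ℕ} (f : (Fin (k + 1) → α) → ℝ) :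
    ev (wt w) f = ev w (fun a => ev (wt w) (fun x : Fin k → α => f (Fin.cons a x))) := by
  simp only [ev, mul_sum]
  rw [← Fintype.sum_prod_type', ← (Fin.consEquiv fun _ : Fin (k + 1) => α).sum_comp]
  refine sum_congr rfl fun x _ => ?_
  simp [Fin.consEquiv, wt, Fin.prod_univ_succ, mul_assoc]

theorem ev_snoc {k : ℕ} (f : (Fin (k + 1) → α) → ℝ) :
    ev (wt w) f = ev (wt w) (fun x : Fin k → α => ev w (fun a => f (Fin.snoc x a))) := by
  simp only [ev, mul_sum]
  rw [← Fintype.sum_prod_type', ← (Fin.snocEquiv fun _ : Fin (k + 1) => α).sum_comp,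
    ← (Equiv.prodComm _ _).sum_comp]
  refine sum_congr rfl fun x _ => ?_
  simp [Fin.snocEquiv, wt, Fin.prod_univ_castSucc, mul_assoc]

theorem pr_forall_wt {ι : Type*} [Fintype ι] [DecidableEq ι] (B : ι → α → Prop) :
    pr (wt w) (fun x : ι → α => ∀ i, B i (x i)) = ∏ i, pr w (B i) := by
  simp only [pr, ev]
  rw [Fintype.prod_sum]
  refine sum_congr rfl fun x _ => ?_
  rw [prod_mul_distrib, wt, prod_boole]
  simp

/-- Resampling the coordinates in the range of an injection does not change the distribution. -/
theorem ev_resample {ι κ : Type*} [Fintype ι] [DecidableEq ι] [Fintype κ] [DecidableEq κ]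
    (hw : IsWeight w) {σ : κ → ι} (hσ : Function.Injective σ) (f : (ι → α) → ℝ) :
    ev (wt w) f = ev (wt w) (fun r => ev (wt w) (fun y : κ → α => f (Function.extend σ y r))) := by
  let e : (ι → α) ≃ ({i // i ∈ Set.range σ} → α) × ({i // ¬ i ∈ Set.range σ} → α) :=
    Equiv.piEquivPiSubtypeProd (fun i => i ∈ Set.range σ) (fun _ : ι => α)
  let τ := Equiv.ofInjective σ hσ
  let g := (Equiv.arrowCongr τ (Equiv.refl α))
  have hwt : ∀ x : ι → α, wt w x = wt w (e x).1 * wt w (e x).2 := fun x => by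
    simp only [wt, e, Equiv.piEquivPiSubtypeProd_apply]
    convert (Fintype.prod_subtype_mul_prod_subtype (fun i => i ∈ Set.range σ) (fun i => w (x i))).symm
  have key : ∀ F : (ι → α) → ℝ, ev (wt w) F =
      ∑ v, wt w v * ∑ u, wt w u * F (e.symm (u, v)) := fun F => by
    simp only [ev, mul_sum]
    rw [← e.symm.sum_comp, Fintype.sum_prod_type_right]
    refine sum_congr rfl fun v _ => sum_congr rfl fun u _ => ?_
    rw [hwt]; simp; ring
  have hext : ∀ u v y, Function.extend σ y (e.symm (u, v)) = e.symm (g y, v) := fun u v y => by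
    ext i
    by_cases hi : i ∈ Set.range σ
    · obtain ⟨k, rfl⟩ := hi
      have : τ.symm ⟨σ k, ⟨k, rfl⟩⟩ = k := τ.injective (by simp [τ])
      simp [hσ.extend_apply, e, Equiv.piEquivPiSubtypeProd, g, this]
    · rw [Function.extend_apply' _ _ _ hi]
      simp only [e, Equiv.piEquivPiSubtypeProd, Equiv.coe_fn_symm_mk, dif_neg hi]
  rw [key, key]
  refine sum_congr rfl fun v _ => ?_
  congr 1
  simp only [hext]
  rw [← sum_mul, (isWeight_wt hw).sum_eq_one, one_mul, ev, ← g.sum_comp]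
  refine sum_congr rfl fun y _ => ?_
  congr 1
  simp only [wt, g]
  rw [← τ.prod_comp]
  simp

theorem pr_resample {ι κ : Type*} [Fintype ι] [DecidableEq ι] [Fintype κ] [DecidableEq κ]
    (hw : IsWeight w) {σ : κ → ι} (hσ : Function.Injective σ) (B : (ι → α) → Prop) :
    pr (wt w) B = ev (wt w) (fun r => pr (wt w) (fun y : κ → α => B (Function.extend σ y r))) :=
  ev_resample hw hσ _

theorem pr_curry {κ ε : Type*} [Fintype κ] [DecidableEq κ] [Fintype ε] [DecidableEq ε]
    (B : (κ × ε → α) → Prop) :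
    pr (wt w) B = pr (wt (wt w)) (fun y : κ → ε → α => B (Function.uncurry y)) := by
  refine (pr_equiv (Equiv.curry κ ε α).symm (fun y => ?_) B).symm
  simp only [wt]
  rw [Fintype.prod_prod_type]
  rfl

end FiniteWeights

/-! ### Linear functionals of independent coordinates: anticoncentration, Fourier bounds,
independent subsets. -/

section Nondegenerate
open scoped Classical
open Finset

/-- A weight on `ZMod p` whose atoms are at most `β < 1` and whose nontrivial Fourier coefficients
are at most `ρ < 1`. -/
structure IsNondeg {p : ℕ} [NeZero p] (m : ZMod p → ℝ) (β ρ : ℝ) : Prop where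
  isWeight : IsWeight m
  le_atom : ∀ x, m x ≤ β
  lt_one : β < 1
  fourier_nonneg : 0 ≤ ρ
  fourier_lt_one : ρ < 1
  fourier_le : ∀ a : ZMod p, a ≠ 0 → ‖∑ x, (m x : ℂ) * ZMod.stdAddChar (a * x)‖ ≤ ρ

variable {p : ℕ} [Fact p.Prime] {m : ZMod p → ℝ} {β ρ : ℝ}

theorem IsNondeg.atom_nonneg (hm : IsNondeg m β ρ) : 0 ≤ β :=
  (hm.isWeight.nonneg 0).trans (hm.le_atom 0)

theorem dotProduct_extend {R ι κ : Type*} [CommRing R] [Fintype ι] [Fintype κ] {σ : κ → ι}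
    (hσ : Function.Injective σ) (w : ι → R) (y : κ → R) (r : ι → R) :
    dotProduct w (Function.extend σ y r) =
      (∑ k, w (σ k) * y k) + dotProduct w (Function.extend σ 0 r) := by
  rw [← sub_eq_iff_eq_add, dotProduct, dotProduct, ← sum_sub_distrib]
  symm
  refine Fintype.sum_of_injective σ hσ _ _ (fun i hi => ?_) fun k => ?_
  · rw [Function.extend_apply' _ _ _ hi, Function.extend_apply' _ _ _ hi, sub_self]
  · simp [hσ.extend_apply]

theorem pr_linear_eq_le (hm : IsNondeg m β ρ) {c : ZMod p} (hc : c ≠ 0) (d z : ZMod p) :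
    pr m (fun x => c * x + d = z) ≤ β := by
  have : ∀ x, c * x + d = z ↔ x = c⁻¹ * (z - d) := fun x => by
    rw [eq_inv_mul_iff_mul_eq₀ hc, eq_sub_iff_add_eq]
  rw [pr_congr this, pr, ev]
  simpa using hm.le_atom _

section Diagonal
variable {ι κ : Type*} [Fintype ι] [Fintype κ]

theorem dotProduct_extend_diag {σ : κ → ι} (hσ : Function.Injective σ) {w : κ → ι → ZMod p}
    (hw : ∀ a b, a ≠ b → w a (σ b) = 0) (r : ι → ZMod p) :
    ∃ d : κ → ZMod p, ∀ (y : κ → ZMod p) (a : κ),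
      dotProduct (w a) (Function.extend σ y r) = w a (σ a) * y a + d a := by
  refine ⟨fun a => dotProduct (w a) (Function.extend σ 0 r), fun y a => ?_⟩
  rw [dotProduct_extend hσ, sum_eq_single a]
  · intro b _ hb; rw [hw a b hb.symm, zero_mul]
  · simp

variable [DecidableEq ι] [DecidableEq κ]

/-- Once the coordinates outside the range of `σ` are fixed, each functional is affine in a private
coordinate, so the events become independent, each of probability at most `β`. -/
theorem pr_dotProduct_eq_le (hm : IsNondeg m β ρ) {σ : κ → ι} (hσ : Function.Injective σ)
    {w : κ → ι → ZMod p} (hw : ∀ a b, a ≠ b → w a (σ b) = 0) (hw' : ∀ a, w a (σ a) ≠ 0)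
    (z : κ → ZMod p) :
    pr (wt m) (fun r => ∀ a, dotProduct (w a) r = z a) ≤ β ^ Fintype.card κ := by
  rw [pr_resample hm.isWeight hσ, ← ev_const (isWeight_wt (ι := ι) hm.isWeight) (β ^ _)]
  refine ev_mono (isWeight_wt hm.isWeight) fun r => ?_
  obtain ⟨d, hd⟩ := dotProduct_extend_diag hσ hw r
  simp only [hd]
  rw [pr_forall_wt (fun a x => w a (σ a) * x + d a = z a),
    ← card_univ, ← prod_const]
  exact prod_le_prod (fun a _ => pr_nonneg hm.isWeight _)
    fun a _ => pr_linear_eq_le hm (hw' a) _ _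

end Diagonal

theorem pr_forall_exists_eq_le (hm : IsNondeg m β ρ) {κ ε ι : Type*} [Fintype ι] [DecidableEq ι]
    [Fintype κ] [DecidableEq κ] [Fintype ε] [DecidableEq ε] {σ : κ × ε → ι}
    (hσ : Function.Injective σ) {w : κ × ε → ι → ZMod p}
    (hw : ∀ a b, a ≠ b → w a (σ b) = 0) (hw' : ∀ a, w a (σ a) ≠ 0) :
    pr (wt m) (fun r => ∀ j, ∃ e, dotProduct (w (j, e)) r = 0) ≤
      (1 - (1 - β) ^ Fintype.card ε) ^ Fintype.card κ := by
  rw [pr_resample hm.isWeight hσ, ← ev_const (isWeight_wt (ι := ι) hm.isWeight) (_ ^ _)]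
  refine ev_mono (isWeight_wt hm.isWeight) fun r => ?_
  obtain ⟨d, hd⟩ := dotProduct_extend_diag hσ hw r
  simp only [hd]
  have hwε := isWeight_wt (ι := ε) hm.isWeight
  rw [pr_curry]
  simp only [Function.uncurry_apply_pair]
  rw [pr_forall_wt (fun j (x : ε → ZMod p) => ∃ e, w (j, e) (σ (j, e)) * x e +
    d (j, e) = 0), ← card_univ (α := κ), ← prod_const]
  refine prod_le_prod (fun a _ => pr_nonneg hwε _) fun j _ => ?_
  have h1 := pr_not hwε (fun x : ε → ZMod p => ∀ e, ¬ (w (j, e) (σ (j, e)) * x e +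
    d (j, e) = 0))
  simp only [not_forall, not_not] at h1
  rw [h1, pr_forall_wt (fun e x => ¬ (w (j, e) (σ (j, e)) * x +
    d (j, e) = 0)), sub_le_sub_iff_left, ← card_univ,
    ← prod_const]
  refine prod_le_prod (fun a _ => sub_nonneg.2 hm.lt_one.le) fun e _ => ?_
  rw [pr_not hm.isWeight, sub_le_sub_iff_left]
  exact pr_linear_eq_le hm (hw' _) _ _

/-- Among many blocks of linear functionals which are diagonal on distinct coordinates, many blocks
are likely to have all values nonzero. -/
theorem exists_le_pr_card_forall_ne (hm : IsNondeg m β ρ) (h : ℕ) (K : ℕ) {δ : ℝ} (hδ : 0 < δ) :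
    ∃ M : ℕ, ∀ {ι ε : Type} [Fintype ι] [DecidableEq ι] [Fintype ε] [DecidableEq ε],
      Fintype.card ε ≤ h →
      ∀ (σ : Fin M × ε → ι), Function.Injective σ → ∀ (w : Fin M × ε → ι → ZMod p),
      (∀ a b, a ≠ b → w a (σ b) = 0) → (∀ a, w a (σ a) ≠ 0) →
      1 - δ ≤ pr (wt m) (fun r => K ≤
        cnt univ (fun i : Fin M => ∀ e, dotProduct (w (i, e)) r ≠ 0)) := by
  have hβ := hm.atom_nonneg
  have hβ1 := hm.lt_one
  set q := 1 - (1 - β) ^ h with hq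
  have hq1 : q < 1 := by rw [hq, sub_lt_self_iff]; exact pow_pos (by linarith) _
  have hq0 : 0 ≤ q := by
    rw [hq, sub_nonneg]; exact pow_le_one₀ (by linarith) (by linarith)
  obtain ⟨g, hg⟩ := exists_pow_lt_of_lt_one (show 0 < δ / (K + 1) by positivity) hq1
  refine ⟨K * g, fun {ι ε} _ _ _ _ hε σ hσ w hw hw' => ?_⟩
  have hW := isWeight_wt (ι := ι) hm.isWeight
  -- The blocks are split into `K` groups of `g`. A group in which every block has a zero value is
  -- so unlikely that a union bound over the groups costs at most `δ`; otherwise every group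
  -- supplies one good block.
  let F : Fin K × Fin g ≃ Fin (K * g) := finProdFinEquiv
  have h1 : ∀ k ∈ (univ : Finset (Fin K)),
      pr (wt m) (fun r => ∀ j : Fin g, ∃ e, dotProduct (w (F (k, j), e)) r = 0) ≤ q ^ g := by
    intro k _
    have hinj : Function.Injective (fun x : Fin g × ε => (F (k, x.1), x.2)) := fun x y hxy => by
      simp only [Prod.mk.injEq, EmbeddingLike.apply_eq_iff_eq, true_and] at hxy
      exact Prod.ext hxy.1 hxy.2
    refine (pr_forall_exists_eq_le (κ := Fin g) (ε := ε) hm (hσ.comp hinj)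
      (w := fun x => w (F (k, x.1), x.2)) (fun a b hab => hw _ _ (hinj.ne hab))
      (fun a => hw' _)).trans ?_
    rw [Fintype.card_fin]
    refine pow_le_pow_left₀ ?_ ?_ _
    · rw [sub_nonneg]; exact pow_le_one₀ (by linarith) (by linarith)
    · rw [hq, sub_le_sub_iff_left]
      exact pow_le_pow_of_le_one (by linarith) (by linarith) hε
  have h2 := (pr_exists_le hW univ _).trans (sum_le_sum h1)
  rw [sum_const, card_univ, Fintype.card_fin, nsmul_eq_mul] at h2
  have h3 : (K : ℝ) * q ^ g ≤ δ := by
    calc (K : ℝ) * q ^ g ≤ (K + 1) * (δ / (K + 1)) := by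
          apply mul_le_mul (by linarith) hg.le (by positivity) (by positivity)
      _ = δ := by field_simp
  have h4 := pr_not hW (fun r => ∃ k ∈ (univ : Finset (Fin K)), ∀ j : Fin g, ∃ e,
    dotProduct (w (F (k, j), e)) r = 0)
  refine le_trans (by rw [h4]; linarith) (pr_le_of_imp hW fun r hr => ?_)
  push Not at hr
  choose j hj using fun k => hr k (mem_univ k)
  have hinj : Function.Injective (fun k => F (k, j k)) := fun a b hab => by
    simpa using congrArg Prod.fst (F.injective hab)
  calc K = (univ.image fun k => F (k, j k)).card := by
        rw [card_image_of_injective _ hinj, card_univ, Fintype.card_fin]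
    _ ≤ _ := card_le_card fun i hi => by
        obtain ⟨k, -, rfl⟩ := mem_image.1 hi
        simpa using hj k

section Fourier

theorem addChar_map_sum {A R κ : Type*} [AddCommMonoid A] [CommMonoid R] (ψ : AddChar A R)
    (s : Finset κ) (f : κ → A) : ψ (∑ i ∈ s, f i) = ∏ i ∈ s, ψ (f i) := by
  induction s using Finset.induction_on with
  | empty => simp
  | insert a s ha ih => rw [sum_insert ha, prod_insert ha, AddChar.map_add_eq_mul, ih]

theorem boole_eq_sum_stdAddChar {κ : Type*} [Fintype κ] [DecidableEq κ] (x : κ → ZMod p) :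
    (if ∀ a, x a = 0 then (1 : ℂ) else 0) =
      ((p : ℂ) ^ Fintype.card κ)⁻¹ * ∑ c : κ → ZMod p, ZMod.stdAddChar (∑ a, c a * x a) := by
  have hp : (p : ℂ) ≠ 0 := by exact_mod_cast (NeZero.ne p)
  rw [eq_inv_mul_iff_mul_eq₀ (pow_ne_zero _ hp)]
  simp only [addChar_map_sum]
  rw [← Fintype.prod_sum (fun (a : κ) (c : ZMod p) => (ZMod.stdAddChar (c * x a) : ℂ))]
  have : ∀ a, ∑ c : ZMod p, (ZMod.stdAddChar (c * x a) : ℂ) = if x a = 0 then (p : ℂ) else 0 := by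
    intro a
    rw [AddChar.sum_mulShift _ (ZMod.isPrimitive_stdAddChar p), ZMod.card]
    simp
  simp only [this]
  by_cases h : ∀ a, x a = 0
  · simp [h]
  · push Not at h
    obtain ⟨a, ha⟩ := h
    rw [prod_eq_zero (mem_univ a) (by simp [ha]), if_neg (fun h => ha (h a)), mul_zero]

theorem norm_sum_wt_mul_stdAddChar_le (hm : IsNondeg m β ρ) {ι : Type*} [Fintype ι]
    [DecidableEq ι] (u : ι → ZMod p) :
    ‖∑ r : ι → ZMod p, (wt m r : ℂ) * ZMod.stdAddChar (dotProduct u r)‖ ≤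
      ρ ^ cnt univ (fun i => u i ≠ 0) := by
  have h1 : ∑ r : ι → ZMod p, (wt m r : ℂ) * ZMod.stdAddChar (dotProduct u r) =
      ∏ i, ∑ x, (m x : ℂ) * ZMod.stdAddChar (u i * x) := by
    rw [Fintype.prod_sum]
    refine sum_congr rfl fun r _ => ?_
    rw [wt, dotProduct, addChar_map_sum, prod_mul_distrib]
    push_cast; rfl
  rw [h1, norm_prod, cnt_eq, ← prod_const, prod_filter]
  refine prod_le_prod (fun _ _ => norm_nonneg _) fun i _ => ?_
  split_ifs with h
  · exact hm.fourier_le _ h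
  · rw [not_not.1 h]
    simp [← Complex.ofReal_sum, hm.isWeight.sum_eq_one]

/-- If all nontrivial combinations of some linear functionals have large support, the values of
these functionals are nearly uniformly distributed. -/
theorem abs_pr_dotProduct_eq_sub_le (hm : IsNondeg m β ρ) {ι κ : Type*} [Fintype ι]
    [DecidableEq ι] [Fintype κ] [DecidableEq κ] (w : κ → ι → ZMod p) (t : ℕ)
    (ht : ∀ c : κ → ZMod p, c ≠ 0 → t ≤ cnt univ (fun i => ∑ a, c a * w a i ≠ 0))
    (z : κ → ZMod p) :
    |pr (wt m) (fun r => ∀ a, dotProduct (w a) r = z a) - ((p : ℝ) ^ Fintype.card κ)⁻¹| ≤ ρ ^ t := by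
  have hp : (p : ℂ) ≠ 0 := by exact_mod_cast (NeZero.ne p)
  set k := Fintype.card κ
  let φ : (κ → ZMod p) → ℂ := fun c => ZMod.stdAddChar (- ∑ a, c a * z a) *
    ∑ r : ι → ZMod p, (wt m r : ℂ) * ZMod.stdAddChar (dotProduct (fun i => ∑ a, c a * w a i) r)
  have h1 : ((pr (wt m) (fun r => ∀ a, dotProduct (w a) r = z a) : ℝ) : ℂ) =
      ((p : ℂ) ^ k)⁻¹ * ∑ c, φ c := by
    simp only [pr, ev, φ]
    push_cast
    have hr : ∀ (r : ι → ZMod p) (_ : Decidable (∀ a, dotProduct (w a) r = z a)),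
        ((if ∀ a, dotProduct (w a) r = z a then (1 : ℝ) else 0 : ℝ) : ℂ) =
        ((p : ℂ) ^ k)⁻¹ * ∑ c : κ → ZMod p, ZMod.stdAddChar (- ∑ a, c a * z a) *
          ZMod.stdAddChar (dotProduct (fun i => ∑ a, c a * w a i) r) := by
      intro r _
      have := boole_eq_sum_stdAddChar (fun a => dotProduct (w a) r - z a)
      simp only [sub_eq_zero] at this
      refine (Eq.trans (by split_ifs <;> simp) this).trans ?_
      congr 1
      refine sum_congr rfl fun c _ => ?_
      rw [← AddChar.map_add_eq_mul]
      congr 1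
      simp only [mul_sub, sum_sub_distrib, dotProduct, sum_mul, mul_sum]
      rw [sum_comm, neg_add_eq_sub]
      simp only [mul_assoc]
    rw [sum_congr rfl fun r _ => by rw [hr r], mul_sum]
    simp only [mul_sum]
    rw [sum_comm]
    refine sum_congr rfl fun c _ => ?_
    refine sum_congr rfl fun r _ => by ring
  -- The zero frequency gives the main term; each other frequency contributes at most `ρ ^ t`.
  have h0 : φ 0 = 1 := by
    simp only [φ]
    simp only [Pi.zero_apply, zero_mul, sum_const_zero, neg_zero, AddChar.map_zero_eq_one, one_mul]
    have : (dotProduct fun _ : ι => (0 : ZMod p)) = fun _ => 0 := by ext r; simp [dotProduct]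
    rw [this]
    simp only [AddChar.map_zero_eq_one, mul_one]
    rw [← Complex.ofReal_sum, (isWeight_wt hm.isWeight).sum_eq_one, Complex.ofReal_one]
  have h2 : ∀ c ∈ (univ : Finset (κ → ZMod p)).erase 0, ‖φ c‖ ≤ ρ ^ t := fun c hc => by
    simp only [φ, norm_mul, AddChar.norm_apply, one_mul]
    exact (norm_sum_wt_mul_stdAddChar_le hm _).trans
      (pow_le_pow_of_le_one hm.fourier_nonneg hm.fourier_lt_one.le (ht c (ne_of_mem_erase hc)))
  have h3 : ((pr (wt m) (fun r => ∀ a, dotProduct (w a) r = z a) -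
      ((p : ℝ) ^ k)⁻¹ : ℝ) : ℂ) = ((p : ℂ) ^ k)⁻¹ * ∑ c ∈ univ.erase 0, φ c := by
    push_cast
    rw [h1, ← add_sum_erase _ _ (mem_univ 0), h0]; ring
  rw [← Real.norm_eq_abs, ← Complex.norm_real, h3, norm_mul, norm_inv, norm_pow,
    Complex.norm_natCast]
  have h4 : ‖∑ c ∈ univ.erase 0, φ c‖ ≤ (p : ℝ) ^ k * ρ ^ t := by
    refine (norm_sum_le_of_le _ h2).trans ?_
    rw [sum_const, nsmul_eq_mul]
    refine mul_le_mul_of_nonneg_right ?_ (pow_nonneg hm.fourier_nonneg _)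
    refine (Nat.cast_le.2 (card_le_univ _)).trans ?_
    simp [k]
  have hpp : (0 : ℝ) < (p : ℝ) ^ k := pow_pos (by exact_mod_cast (NeZero.pos p)) _
  rw [inv_mul_le_iff₀ hpp]
  exact h4

/-- Conditionally on the coordinates in `Y`, a linear functional of large support is nearly uniformly
distributed. -/
theorem pr_dotProduct_extend_eq_le (hm : IsNondeg m β ρ) {ι : Type*} [Fintype ι]
    [DecidableEq ι] (w : ι → ZMod p) (Y : Finset ι) (t : ℕ)
    (ht : t + Y.card ≤ cnt univ (fun i => w i ≠ 0)) (r : ι → ZMod p) :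
    pr (wt m) (fun y : {i // i ∉ Y} → ZMod p =>
      dotProduct w (Function.extend Subtype.val y r) = 0) ≤ 1 / p + ρ ^ t := by
  obtain ⟨d, hd⟩ : ∃ d, ∀ y : {i // i ∉ Y} → ZMod p,
      dotProduct w (Function.extend Subtype.val y r) = (∑ k : {i // i ∉ Y}, w k * y k) + d :=
    ⟨_, fun y => dotProduct_extend Subtype.val_injective w y r⟩
  simp only [hd]
  have := abs_pr_dotProduct_eq_sub_le hm (κ := Unit) (ι := {i // i ∉ Y}) (fun _ i => w i) t
    (fun c hc => ?_) (fun _ => - d)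
  · simp only [forall_const, Fintype.card_unit, pow_one] at this
    rw [abs_le] at this
    refine le_trans (le_of_eq (pr_congr fun y => ?_)) (show _ ≤ _ by
      have := this.2; rw [one_div]; linarith)
    exact (eq_neg_iff_add_eq_zero).symm
  · have hc' : c () ≠ 0 := fun h => hc (by ext; simpa using h)
    simp only [univ_unique, sum_singleton, ne_eq, mul_eq_zero, PUnit.default_eq_unit, hc', false_or]
    rw [cnt_eq] at ht ⊢
    have h1 : (univ.filter fun i => w i ≠ 0) ⊆
        ((univ.filter fun i : {i // i ∉ Y} => w i ≠ 0).map (Function.Embedding.subtype _)) ∪ Y := by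
      intro i hi
      by_cases hY : i ∈ Y
      · simp [hY]
      · simpa [hY] using hi
    have h2 := (card_le_card h1).trans (card_union_le _ _)
    rw [card_map] at h2
    have h3 := ht.trans h2
    simp only [ne_eq] at h3
    omega

end Fourier

/-- A relation of small out-degree has a large independent subset. -/
theorem exists_independent_subset {V : Type*} (R : V → V → Prop) (Δ : ℕ) (M : ℕ) :
    ∀ A : Finset V, (∀ i ∈ A, cnt A (fun j => R i j) ≤ Δ) → (2 * Δ + 1) * M ≤ A.card →
      ∃ B ⊆ A, B.card = M ∧ ∀ i ∈ B, ∀ j ∈ B, i ≠ j → ¬ R i j := by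
  induction M with
  | zero => exact fun A _ _ => ⟨∅, by simp, by simp, by simp⟩
  | succ M ih =>
    intro A hA hc
    have hne : A.Nonempty := card_pos.1 (lt_of_lt_of_le (by positivity) hc)
    -- In-degrees and out-degrees have the same sum, so some `v` has in-degree at most `Δ`. Choosing
    -- it discards at most `2 * Δ + 1` elements: itself and its neighbours in both directions.
    obtain ⟨v, hv, hin⟩ : ∃ v ∈ A, cnt A (fun i => R i v) ≤ Δ := by
      have h1 : ∑ v ∈ A, cnt A (fun i => R i v) ≤ ∑ v ∈ A, Δ := by
        have := sum_card_bipartiteAbove_eq_sum_card_bipartiteBelow (s := A) (t := A) R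
        simp only [bipartiteAbove, bipartiteBelow] at this
        simp only [cnt] at hA ⊢
        rw [← this]
        exact sum_le_sum hA
      exact exists_le_of_sum_le hne h1
    set A' := A.filter fun j => j ≠ v ∧ ¬ R v j ∧ ¬ R j v with hA'
    have hsub : A' ⊆ A := filter_subset _ _
    have hcov : A ⊆ A' ∪ (({v} : Finset V) ∪ ((A.filter fun j => R v j) ∪
        (A.filter fun i => R i v))) := by
      intro j hj
      simp only [hA', mem_union, mem_filter, mem_singleton, hj, true_and]
      tauto
    have h1 := card_le_card hcov
    have h2 := card_union_le A' (({v} : Finset V) ∪ ((A.filter fun j => R v j) ∪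
        (A.filter fun i => R i v)))
    have h3 := card_union_le ({v} : Finset V) ((A.filter fun j => R v j) ∪
        (A.filter fun i => R i v))
    have h4 := card_union_le (A.filter fun j => R v j) (A.filter fun i => R i v)
    have h5 := hA v hv
    rw [cnt] at h5 hin
    rw [card_singleton] at h3
    obtain ⟨B, hBA, hBc, hB⟩ := ih A' (fun i hi =>
      (cnt_le_cnt hsub fun _ _ => id).trans (hA i (hsub hi)))
      (by rw [mul_add, mul_one] at hc; omega)
    have hvB : v ∉ B := fun h => by simpa [hA'] using hBA h
    refine ⟨insert v B, insert_subset hv (hBA.trans hsub), by rw [card_insert_of_notMem hvB, hBc],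
      fun i hi j hj hij => ?_⟩
    rcases mem_insert.1 hi with rfl | hi' <;> rcases mem_insert.1 hj with rfl | hj'
    · exact absurd rfl hij
    · exact (mem_filter.1 (hBA hj')).2.2.1
    · exact (mem_filter.1 (hBA hi')).2.2.2
    · exact hB i hi' j hj' hij

end Nondegenerate

/-! ### Many disjoint blocks of functionals: some value of the block is nonzero. -/

section Blocks
open scoped Classical
open Finset

variable {p : ℕ} [Fact p.Prime] {m : ZMod p → ℝ} {β ρ : ℝ}

/-- Disjoint blocks meet the support in different points. This bounds the out-degree in the
interaction relation between blocks. -/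
theorem cnt_exists_ne_zero_le {V κ ι R : Type*} [Zero R] [Fintype ι] {s : V → κ → ι}
    (hs : Function.Injective (Function.uncurry s)) (u : ι → R) (A : Finset V) :
    cnt A (fun j => ∃ f, u (s j f) ≠ 0) ≤ cnt univ (fun i => u i ≠ 0) := by
  rw [cnt, cnt]
  refine card_le_card_of_forall_subsingleton (fun j i => ∃ f, s j f = i) (fun j hj => ?_)
    fun i _ j hj j' hj' => ?_
  · obtain ⟨f, hf⟩ := (mem_filter.1 hj).2
    exact ⟨s j f, by simpa using hf, f, rfl⟩
  · obtain ⟨f, hf⟩ := hj.2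
    obtain ⟨f', hf'⟩ := hj'.2
    exact congrArg Prod.fst (@hs (j, f) (j', f') (by simp [hf, hf']))

theorem exists_pow_le_of_lt_one {x : ℝ} (hx : x < 1) {δ : ℝ} (hδ : 0 < δ) :
    ∃ t : ℕ, x ^ t ≤ δ :=
  (exists_pow_lt_of_lt_one hδ hx).imp fun _ h => h.le

theorem exists_div_le (L : ℕ) {δ : ℝ} (hδ : 0 < δ) :
    ∃ K : ℕ, 0 < K ∧ ∀ n : ℕ, K ≤ n → (L : ℝ) / n ≤ δ := by
  obtain ⟨K, hK⟩ := exists_nat_ge (L / δ)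
  refine ⟨K + 1, K.succ_pos, fun n hn => ?_⟩
  have hn' : (K : ℝ) + 1 ≤ n := by exact_mod_cast hn
  rw [div_le_iff₀ hδ] at hK
  rw [div_le_iff₀ (by linarith [(Nat.cast_nonneg K : (0 : ℝ) ≤ K)])]
  nlinarith

/-- Given many blocks of `k` linear functionals each of which is independent on its own coordinates,
with probability at least about `1 - p ^ (-k)` many blocks have a nonzero value. -/
theorem exists_le_pr_card_exists_ne (hm : IsNondeg m β ρ) (k L : ℕ) {δ : ℝ} (hδ : 0 < δ) :
    ∃ N₀ : ℕ, ∀ {V ι : Type} [Fintype V] [Fintype ι] [DecidableEq ι], N₀ ≤ Fintype.card V →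
      ∀ s : V → Fin k → ι, Function.Injective (Function.uncurry s) →
      ∀ w : V → Fin k → ι → ZMod p,
      (∀ i, ∀ c : Fin k → ZMod p, c ≠ 0 → ∃ b, ∑ a, c a * w i a (s i b) ≠ 0) →
      1 - ((p : ℝ) ^ k)⁻¹ - δ ≤ pr (wt m) (fun r => L ≤
        cnt univ (fun i : V => ∃ a, dotProduct (w i a) r ≠ 0)) := by
  obtain ⟨t, ht⟩ := exists_pow_le_of_lt_one hm.fourier_lt_one (half_pos hδ)
  obtain ⟨M, hM⟩ := exists_le_pr_card_forall_ne hm 1 L hδ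
  obtain ⟨K, hK0, hK⟩ := exists_div_le L (half_pos hδ)
  refine ⟨(2 * t + 1) * M + K, fun {V ι} _ _ _ hV s hs w hw => ?_⟩
  have hW := isWeight_wt (ι := ι) hm.isWeight
  by_cases hk : k = 0
  · subst hk
    refine le_trans ?_ (pr_nonneg hW _)
    simp [hδ.le]
  -- Dichotomy. If many blocks have a nontrivial combination of small support, an independent
  -- subfamily of these makes many combinations nonzero almost surely. Otherwise many blocks have
  -- only combinations of large support; each of these has a nonzero value with probability about `1
  -- - p ^ (-k)`, and averaging over the blocks needs no independence.
  set A : Finset V := univ.filter fun i => ∃ c : Fin k → ZMod p, c ≠ 0 ∧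
    cnt univ (fun j => ∑ a, c a * w i a j ≠ 0) < t with hA
  rcases le_or_gt ((2 * t + 1) * M) A.card with h | h
  · have : ∀ i : V, ∃ c : Fin k → ZMod p, ∃ b, i ∈ A → ∑ a, c a * w i a (s i b) ≠ 0 ∧
        cnt univ (fun j => ∑ a, c a * w i a j ≠ 0) < t := by
      intro i
      by_cases hi : i ∈ A
      · obtain ⟨c, hc, hct⟩ := (mem_filter.1 hi).2
        obtain ⟨b, hb⟩ := hw i c hc
        exact ⟨c, b, fun _ => ⟨hb, hct⟩⟩
      · exact ⟨0, ⟨0, Nat.pos_of_ne_zero hk⟩, fun h => absurd h hi⟩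
    choose c b hcb using this
    let u : V → ι → ZMod p := fun i j => ∑ a, c i a * w i a j
    obtain ⟨B, hBA, hBc, hB⟩ := exists_independent_subset (fun i j => u i (s j (b j)) ≠ 0) t M A
      (fun i hi => by
        exact le_trans (cnt_le_cnt subset_rfl fun j _ hj => ⟨b j, hj⟩)
          ((cnt_exists_ne_zero_le hs (u i) A).trans (hcb i hi).2.le)) h
    let e := B.equivFinOfCardEq hBc
    have he : ∀ x, (e.symm x : V) ∈ B := fun x => (e.symm x).2
    have hinj : Function.Injective (fun x => (e.symm x : V)) :=
      Subtype.val_injective.comp e.symm.injective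
    have := hM (ι := ι) (ε := Unit) (by simp) (fun x => s (e.symm x.1) (b (e.symm x.1)))
      (fun x y hxy => by
        have := congrArg Prod.fst (@hs (_, _) (_, _) hxy)
        exact Prod.ext (hinj this) rfl)
      (fun x => u (e.symm x.1))
      (fun x y hxy => not_not.1 (hB _ (he _) _ (he _)
        (fun h => hxy (Prod.ext (hinj h) rfl))))
      (fun x => (hcb _ (hBA (he _))).1)
    have hp : (0 : ℝ) ≤ ((p : ℝ) ^ k)⁻¹ := by positivity
    refine le_trans (by linarith) (this.trans (pr_le_of_imp hW fun r hr => hr.trans ?_))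
    refine cnt_le_cnt_of_injective hinj fun x hx => ?_
    by_contra hne
    push Not at hne
    apply hx ()
    have : dotProduct (u (e.symm x)) r = ∑ a, c (e.symm x) a * dotProduct (w (e.symm x) a) r := by
      simp only [u, dotProduct, sum_mul, mul_sum]
      rw [sum_comm]
      simp only [mul_assoc]
    rw [this]
    exact sum_eq_zero fun a _ => by rw [hne a, mul_zero]
  · have hAc : K ≤ Aᶜ.card := by rw [card_compl]; omega
    have h1 := le_pr_card_filter hW Aᶜ (card_pos.1 (hK0.trans_le hAc))
      (fun i r => ∃ a, dotProduct (w i a) r ≠ 0) (1 - ((p : ℝ) ^ k)⁻¹ - δ / 2) L (fun i hi => by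
        have hi' : ∀ c : Fin k → ZMod p, c ≠ 0 →
            t ≤ cnt univ (fun j => ∑ a, c a * w i a j ≠ 0) := by
          simpa [hA] using hi
        have h2 := abs_pr_dotProduct_eq_sub_le hm (w i) t hi' 0
        have h3 := pr_not hW (fun r => ∀ a, dotProduct (w i a) r = 0)
        simp only [not_forall] at h3
        simp only [Pi.zero_apply, Fintype.card_fin] at h2
        rw [h3]
        have := (abs_le.1 h2).2
        linarith)
    refine le_trans ?_ (h1.trans (pr_le_of_imp hW fun r hr => hr.trans
      (cnt_le_cnt (subset_univ _) fun _ _ => id)))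
    linarith [hK _ hAc]

end Blocks

/-! ### Many disjoint blocks of functionals: few values of the block vanish. -/

section FewZeros
open scoped Classical
open Finset

variable {p : ℕ} [Fact p.Prime] {m : ZMod p → ℝ} {β ρ : ℝ}

/-- For families of at least `N` blocks of `k` diagonal functionals, such that the functionals
indexed by `E` have support of size at most `l`, it is likely that `L` blocks have at most `z`
zeros. -/
def FewZeros (m : ZMod p → ℝ) (k z L : ℕ) (δ : ℝ) (E : Finset (Fin k)) (l N : ℕ) : Prop :=
  ∀ {V ι : Type} [Fintype V] [Fintype ι] [DecidableEq ι], N ≤ Fintype.card V →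
    ∀ s : V → Fin k → ι, Function.Injective (Function.uncurry s) →
    ∀ w : V → Fin k → ι → ZMod p,
    (∀ i a b, a ≠ b → w i a (s i b) = 0) → (∀ i a, w i a (s i a) ≠ 0) →
    (∀ i, ∀ e ∈ E, cnt univ (fun j => w i e j ≠ 0) ≤ l) →
    1 - (k : ℝ) / ((z + 1) * p) - δ ≤ pr (wt m) (fun r => L ≤
      cnt univ (fun i : V => cnt univ (fun a => dotProduct (w i a) r = 0) ≤ z))

theorem dotProduct_extend_of_support_subset {R ι : Type*} [CommRing R] [Fintype ι] {u : ι → R}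
    {Y : Finset ι} (h : ∀ i, u i ≠ 0 → i ∈ Y) (r : ι → R) (y : {i // i ∉ Y} → R) :
    dotProduct u (Function.extend Subtype.val y r) = dotProduct u r := by
  refine sum_congr rfl fun i _ => ?_
  by_cases hi : i ∈ Y
  · rw [Function.extend_apply']
    rintro ⟨x, rfl⟩
    exact x.2 hi
  · rw [not_not.1 (mt (h i) hi), zero_mul, zero_mul]

/-- The case in which all functionals not indexed by `E` have large support, with the blocks not
interacting through the functionals indexed by `E`. -/
theorem le_pr_cnt_few_zeros (hm : IsNondeg m β ρ) {k z L K M l t : ℕ} {δ : ℝ} (hδ : 0 < δ)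
    {E : Finset (Fin k)} (hK0 : 0 < K) (hK : ∀ n : ℕ, K ≤ n → (L : ℝ) / n ≤ δ)
    (ht : ρ ^ t ≤ δ / (k + 1))
    {ι : Type} [Fintype ι] [DecidableEq ι] {w : Fin M → Fin k → ι → ZMod p}
    (hsurv : 1 - δ ≤ pr (wt m) (fun r => K ≤
        cnt univ (fun i : Fin M => ∀ e : E, dotProduct (w i e) r ≠ 0)))
    (hl : ∀ i, ∀ e ∈ E, cnt univ (fun j => w i e j ≠ 0) ≤ l)
    (hh : ∀ i, ∀ e ∉ E, t + M * (k * l) ≤ cnt univ (fun j => w i e j ≠ 0)) :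
    1 - (k : ℝ) / ((z + 1) * p) - 3 * δ ≤ pr (wt m) (fun r => L ≤
      cnt univ (fun i : Fin M => cnt univ (fun a => dotProduct (w i a) r = 0) ≤ z)) := by
  have hW := isWeight_wt (ι := ι) hm.isWeight
  -- `Y` contains the supports of all functionals indexed by `E`. Fixing the coordinates in `Y`
  -- decides which blocks have all these values nonzero, while the other functionals keep at least
  -- `t` free coordinates and remain nearly uniform.
  let Y : Finset ι := (univ : Finset (Fin M)).biUnion fun i => E.biUnion fun e =>
    univ.filter fun j => w i e j ≠ 0
  have hY : ∀ i, ∀ e ∈ E, ∀ j, w i e j ≠ 0 → j ∈ Y := fun i e he j hj => by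
    simp only [Y, mem_biUnion, mem_filter, mem_univ, true_and]
    exact ⟨i, e, he, hj⟩
  have hYc : Y.card ≤ M * (k * l) := by
    have h1 : ∀ i : Fin M, (E.biUnion fun e => univ.filter fun j => w i e j ≠ 0).card ≤ k * l :=
      fun i => (card_biUnion_le_card_mul _ _ l fun e he => by
        have := hl i e he; rwa [cnt_eq] at this).trans
        (Nat.mul_le_mul_right _ ((card_le_univ E).trans (by simp)))
    exact (card_biUnion_le_card_mul _ _ _ fun i _ => h1 i).trans (by simp)
  have hWY := isWeight_wt (ι := {i // i ∉ Y}) hm.isWeight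
  have hp : (0 : ℝ) < p := by exact_mod_cast (NeZero.pos p)
  set G : (ι → ZMod p) → Prop := fun r => K ≤
        cnt univ (fun i : Fin M => ∀ e : E, dotProduct (w i e) r ≠ 0) with hG
  set c₀ : ℝ := (k : ℝ) / ((z + 1) * p) + 2 * δ with hc₀
  have hc₀' : 0 ≤ c₀ := by positivity
  have key : ∀ r, (if G r then 1 else 0) - c₀ ≤ pr (wt m) (fun y : {i // i ∉ Y} → ZMod p => L ≤
      cnt univ (fun i : Fin M =>
        cnt univ (fun a => dotProduct (w i a) (Function.extend Subtype.val y r) = 0) ≤ z)) := by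
    intro r
    split_ifs with hr
    · set S : Finset (Fin M) := univ.filter fun i => ∀ e : E, dotProduct (w i e) r ≠ 0 with hS
      have hSK : K ≤ S.card := by rw [hG, cnt_eq] at hr; exact hr
      have hev : ∀ i ∈ S, 1 - ((k : ℝ) / ((z + 1) * p) + δ) ≤
          pr (wt m) (fun y : {i // i ∉ Y} → ZMod p =>
            cnt univ (fun a => dotProduct (w i a) (Function.extend Subtype.val y r) = 0) ≤ z) := by
        intro i hi
        -- Markov: about `k / p` zeros are expected at most, so more than `z` of them occur with
        -- probability at most about `k / ((z + 1) * p)`.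
        have h1 := mul_pr_le_card_filter hWY (univ \ E)
          (fun a y => dotProduct (w i a) (Function.extend Subtype.val y r) = 0) (z + 1)
        have h2 : ∀ a ∈ univ \ E, pr (wt m) (fun y : {i // i ∉ Y} → ZMod p =>
            dotProduct (w i a) (Function.extend Subtype.val y r) = 0) ≤ 1 / p + δ / (k + 1) :=
          fun a ha => (pr_dotProduct_extend_eq_le hm (w i a) Y t
            ((Nat.add_le_add_left hYc t).trans (hh i a (mem_sdiff.1 ha).2)) r).trans (by linarith)
        have h3 := h1.trans ((sum_le_card_nsmul _ _ _ h2).trans_eq (nsmul_eq_mul _ _))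
        have h4 : ((univ \ E).card : ℝ) * (1 / p + δ / (k + 1)) ≤ k / p + δ := by
          have : ((univ \ E).card : ℝ) ≤ k := by
            exact_mod_cast (card_le_univ _).trans (by simp)
          calc _ ≤ (k : ℝ) * (1 / p + δ / (k + 1)) :=
                mul_le_mul_of_nonneg_right this (by positivity)
            _ = k / p + k / (k + 1) * δ := by ring
            _ ≤ k / p + 1 * δ := by
                gcongr; rw [div_le_one (by positivity)]; linarith
            _ = _ := by ring
        have h5 := pr_not hWY (fun y : {i // i ∉ Y} → ZMod p => ((z : ℝ) + 1) ≤
          (cnt (univ \ E) (fun a => dotProduct (w i a) (Function.extend Subtype.val y r) = 0) : ℝ))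
        have hz : (0 : ℝ) < z + 1 := by positivity
        have h6 : pr (wt m) (fun y : {i // i ∉ Y} → ZMod p => ((z : ℝ) + 1) ≤
            (cnt (univ \ E) (fun a => dotProduct (w i a) (Function.extend Subtype.val y r) = 0) : ℝ))
            ≤ (k : ℝ) / ((z + 1) * p) + δ := by
          have h7 := (le_div_iff₀' hz).2 (h3.trans h4)
          refine h7.trans ?_
          rw [add_div, div_div, mul_comm (p : ℝ)]
          gcongr
          exact div_le_self hδ.le (by linarith [(Nat.cast_nonneg z : (0 : ℝ) ≤ z)])
        refine le_trans (by rw [h5]; linarith) (pr_le_of_imp hWY fun y hy => ?_)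
        refine le_trans (cnt_le_cnt_of_imp fun a _ ha => ?_)
          (Nat.lt_succ_iff.1 (by exact_mod_cast not_le.1 hy))
        refine ⟨mem_sdiff.2 ⟨mem_univ _, fun haE => ?_⟩, ha⟩
        rw [dotProduct_extend_of_support_subset (hY i a haE)] at ha
        exact (mem_filter.1 hi).2 ⟨a, haE⟩ ha
      have h1 := le_pr_card_filter hWY S (card_pos.1 (hK0.trans_le hSK)) _ _ L hev
      refine le_trans ?_ (h1.trans (pr_le_of_imp hWY fun y hy => hy.trans
        (cnt_le_cnt (subset_univ _) fun _ _ => id)))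
      linarith [hK _ hSK]
    · linarith [pr_nonneg hWY (fun y : {i // i ∉ Y} → ZMod p => L ≤
        cnt univ (fun i : Fin M =>
        cnt univ (fun a => dotProduct (w i a) (Function.extend Subtype.val y r) = 0) ≤ z))]
  rw [pr_resample hm.isWeight (Subtype.val_injective (p := fun i => i ∉ Y))]
  refine le_trans ?_ (ev_mono hW key)
  rw [ev_sub, ev_const hW]
  have : pr (wt m) G - c₀ = (ev (wt m) fun r => if G r then 1 else 0) - c₀ := by
    rw [pr]; congr!
  linarith

/-- Given many blocks of `k` diagonal linear functionals, with probability at least about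
`1 - k / ((z + 1) p)` many blocks have at most `z` zero values. -/
theorem exists_fewZeros (hm : IsNondeg m β ρ) (k z L : ℕ) {δ : ℝ} (hδ : 0 < δ) :
    ∀ (n : ℕ) (E : Finset (Fin k)), (univ \ E).card = n → ∀ l, ∃ N, FewZeros m k z L δ E l N := by
  intro n
  induction n using Nat.strong_induction_on with
  | _ n ih =>
  intro E hE l
  have hδ3 : 0 < δ / 3 := by positivity
  obtain ⟨K, hK0, hK⟩ := exists_div_le L hδ3
  obtain ⟨t, ht⟩ := exists_pow_le_of_lt_one hm.fourier_lt_one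
    (show 0 < (δ / 3) / (k + 1) by positivity)
  obtain ⟨M, hM⟩ := exists_le_pr_card_forall_ne hm k K hδ3
  -- Chosen after `M`: support above `l'` leaves `t` coordinates outside `M` blocks' worth of short
  -- supports, and the summand `l` keeps the old bound valid when `E` grows.
  set l' := t + M * (k * l) + l with hl'
  obtain ⟨N', hN'⟩ : ∃ N', ∀ e ∉ E, FewZeros m k z L δ (insert e E) l' N' := by
    have : ∀ e, ∃ N', e ∉ E → FewZeros m k z L δ (insert e E) l' N' := fun e => by
      by_cases he : e ∈ E
      · exact ⟨0, fun h => absurd he h⟩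
      · obtain ⟨N', h⟩ := ih _ (by
          rw [← hE, sdiff_insert]
          exact card_erase_lt_of_mem (mem_sdiff.2 ⟨mem_univ _, he⟩)) (insert e E) rfl l'
        exact ⟨N', fun _ => h⟩
    choose f hf using this
    exact ⟨univ.sup f, fun e he {V ι} _ _ _ hV => hf e he ((le_sup (mem_univ e)).trans hV)⟩
  refine ⟨(2 * (k * l) + 1) * M + (k * N' + 1), fun {V ι} _ _ _ hV s hs w hw0 hw1 hl => ?_⟩
  have hW := isWeight_wt (ι := ι) hm.isWeight
  -- Either many blocks have large support at every index outside `E`, and short and long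
  -- functionals separate; or by pigeonhole one index `e` has short support in many blocks and can
  -- be added to `E`.
  set A : Finset V := univ.filter fun i => ∀ e ∉ E, l' < cnt univ (fun j => w i e j ≠ 0) with hA
  rcases le_or_gt ((2 * (k * l) + 1) * M) A.card with h | h
  · obtain ⟨B, hBA, hBc, hB⟩ := exists_independent_subset
      (fun i j => ∃ e ∈ E, ∃ f, w i e (s j f) ≠ 0) (k * l) M A (fun i _ => by
        have h1 : cnt A (fun j => ∃ e ∈ E, ∃ f, w i e (s j f) ≠ 0) ≤
            (E.biUnion fun e => A.filter fun j => ∃ f, w i e (s j f) ≠ 0).card :=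
          cnt_le_card_of_imp fun j hjA ⟨e, he, hf⟩ => by
            exact mem_biUnion.2 ⟨e, he, mem_filter.2 ⟨hjA, hf⟩⟩
        refine h1.trans ((card_biUnion_le_card_mul _ _ l fun e he => ?_).trans
          (Nat.mul_le_mul_right _ ((card_le_univ E).trans (by simp))))
        rw [← cnt_eq]
        exact (cnt_exists_ne_zero_le hs (w i e) A).trans (hl i e he)) h
    let b := B.equivFinOfCardEq hBc
    have hb : ∀ x, (b.symm x : V) ∈ B := fun x => (b.symm x).2
    have hinj : Function.Injective (fun x => (b.symm x : V)) :=
      Subtype.val_injective.comp b.symm.injective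
    have hsurv := hM (ι := ι) (ε := E) (by simpa using card_le_univ E)
      (fun x => s (b.symm x.1) x.2)
      (fun x y hxy => by
        have := @hs (_, _) (_, _) hxy
        exact Prod.ext (hinj (congrArg Prod.fst this))
          (Subtype.ext (congrArg Prod.snd this)))
      (fun x => w (b.symm x.1) x.2)
      (fun x y hxy => by
        by_cases h1 : x.1 = y.1
        · rw [h1]
          exact hw0 _ _ _ fun h2 => hxy (Prod.ext h1 (Subtype.ext h2))
        · by_contra hne
          exact hB _ (hb x.1) _ (hb y.1) (fun h => h1 (hinj h)) ⟨x.2, x.2.2, y.2, hne⟩)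
      (fun x => hw1 _ _)
    have := le_pr_cnt_few_zeros (z := z) (w := fun x => w (b.symm x)) hm hδ3 hK0 hK ht hsurv
      (fun i => hl _)
      (fun i e he => by
        have := (mem_filter.1 (hBA (hb i))).2 e he
        omega)
    refine le_trans (by linarith) (this.trans (pr_le_of_imp hW fun r hr => hr.trans ?_))
    exact cnt_le_cnt_of_injective hinj fun x hx => hx
  · obtain ⟨e, he, hNe⟩ : ∃ e ∉ E, N' ≤ cnt univ (fun i : V =>
        cnt univ (fun j => w i e j ≠ 0) ≤ l') := by
      by_contra hcon
      push Not at hcon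
      have h1 : Aᶜ ⊆ (univ \ E).biUnion fun e => univ.filter fun i : V =>
          cnt univ (fun j => w i e j ≠ 0) ≤ l' := fun i hi => by
        simp only [hA, mem_compl, mem_filter, mem_univ, true_and, not_forall, not_lt] at hi
        obtain ⟨e, he, h⟩ := hi
        exact mem_biUnion.2 ⟨e, by simpa using he, by simpa using h⟩
      have h2 := (card_le_card h1).trans (card_biUnion_le_card_mul _ _ N' fun e he => by
        have := hcon e (mem_sdiff.1 he).2
        rw [cnt_eq] at this
        exact this.le)
      have h3 : (univ \ E).card * N' ≤ k * N' :=
        Nat.mul_le_mul_right _ ((card_le_univ _).trans (by simp))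
      rw [card_compl] at h2
      omega
    rw [cnt_eq] at hNe
    have := @hN' e he {i : V // cnt univ (fun j => w i e j ≠ 0) ≤ l'} ι _ _ _
      (by rwa [Fintype.card_subtype]) (fun i => s i)
      (fun x y hxy => by
        have := @hs (_, _) (_, _) hxy
        exact Prod.ext (Subtype.ext (Prod.ext_iff.1 this).1) (Prod.ext_iff.1 this).2)
      (fun i => w i) (fun i => hw0 i) (fun i => hw1 i) (fun i e' he' => by
        rcases mem_insert.1 he' with rfl | h'
        · exact i.2
        · exact (hl i e' h').trans (by omega))
    refine this.trans (pr_le_of_imp hW fun r hr => hr.trans ?_)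
    exact cnt_le_cnt_of_injective Subtype.val_injective fun x hx => hx

end FewZeros

/-! ### One contraction: how robustness passes to the next lower degree. -/

section Lowering
open scoped Classical
open Finset

/-- Contraction of a square-free form, given by its coefficients, with a vector. -/
def low {R ι : Type*} [CommRing R] [Fintype ι] [DecidableEq ι] (r : ι → R) (T : Finset ι → R) :
    Finset ι → R :=
  fun S => ∑ a ∈ Sᶜ, r a * T (insert a S)

/-- The coefficients of the linear functional `fun r => low r T S`. -/
def lowFunctional {R ι : Type*} [CommRing R] [DecidableEq ι] (T : Finset ι → R)
    (S : Finset ι) : ι → R :=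
  fun a => if a ∈ S then 0 else T (insert a S)

theorem dotProduct_lowFunctional {R ι : Type*} [CommRing R] [Fintype ι] [DecidableEq ι]
    (r : ι → R) (T : Finset ι → R) (S : Finset ι) :
    dotProduct (lowFunctional T S) r = low r T S := by
  rw [low, dotProduct, ← sum_subset (subset_univ Sᶜ)]
  · exact sum_congr rfl fun a ha => by
      rw [lowFunctional, if_neg (mem_compl.1 ha), mul_comm]
  · intro a _ ha
    rw [lowFunctional, if_pos (by simpa using ha), zero_mul]

/-- There are `L` disjoint sets of size `d` on which the coefficients of `T` are nonzero. -/
def Robust {R ι : Type*} [Zero R] [DecidableEq ι] (T : Finset ι → R) (d L : ℕ) : Prop :=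
  ∃ s : Fin L → Fin d → ι, Function.Injective (Function.uncurry s) ∧
    ∀ i, T (univ.image (s i)) ≠ 0

/-- There are `L` disjoint sets of size `d + 1`, each of which has at least three subsets of
size `d` on which the coefficients of `T` are nonzero. -/
def RobustTriple {R ι : Type*} [Zero R] [DecidableEq ι] (T : Finset ι → R) (d L : ℕ) : Prop :=
  ∃ s : Fin L → Fin (d + 1) → ι, Function.Injective (Function.uncurry s) ∧
    ∀ i, cnt univ (fun a => T ((univ.image (s i)).erase (s i a)) = 0) + 2 ≤ d

theorem image_comp_succAbove {ι : Type*} [DecidableEq ι] {d : ℕ} {s : Fin (d + 1) → ι}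
    (hs : Function.Injective s) (a : Fin (d + 1)) :
    univ.image (s ∘ a.succAbove) = (univ.image s).erase (s a) := by
  rw [← image_image, Fin.image_succAbove_univ, ← sdiff_singleton_eq_erase, ← image_singleton,
    ← image_sdiff _ _ hs, compl_eq_univ_sdiff]

theorem exists_injective_of_le_cnt {V : Type*} [Fintype V] {P : V → Prop} {L : ℕ}
    (h : L ≤ cnt univ P) : ∃ f : Fin L → V, Function.Injective f ∧ ∀ x, P (f x) := by
  rw [cnt_eq, ← Fintype.card_subtype, ← Fintype.card_fin L] at h
  obtain ⟨f⟩ := Function.Embedding.nonempty_of_card_le h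
  exact ⟨fun x => f (x.cast (by simp)), fun x y hxy => by simpa using f.injective (Subtype.ext hxy),
    fun x => (f _).2⟩

theorem Function.Injective.uncurry_apply {V κ ι : Type*} {s : V → κ → ι}
    (hs : Function.Injective (Function.uncurry s)) (i : V) : Function.Injective (s i) :=
  fun a b hab => congrArg Prod.snd (@hs (i, a) (i, b) hab)

theorem robust_of_le_cnt {V κ ι R : Type*} [Fintype V] [Zero R] [DecidableEq ι]
    {T : Finset ι → R} {d L : ℕ} {s : V → κ → ι} (hs : Function.Injective (Function.uncurry s))
    (h : L ≤ cnt univ (fun i => ∃ g : Fin d → κ, Function.Injective g ∧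
      T (univ.image (s i ∘ g)) ≠ 0)) : Robust T d L := by
  obtain ⟨f, hf, hP⟩ := exists_injective_of_le_cnt h
  choose g hg hT using hP
  refine ⟨fun x => s (f x) ∘ g x, fun x y hxy => ?_, hT⟩
  have h1 := @hs (f x.1, g x.1 x.2) (f y.1, g y.1 y.2) hxy
  obtain ⟨x1, x2⟩ := x
  obtain ⟨y1, y2⟩ := y
  simp only [Prod.mk.injEq] at h1
  obtain rfl := hf h1.1
  rw [hg _ h1.2]

theorem RobustTriple.robust {R ι : Type*} [Zero R] [DecidableEq ι] {T : Finset ι → R} {d L : ℕ}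
    (h : RobustTriple T d L) : Robust T d L := by
  obtain ⟨s, hs, hT⟩ := h
  refine robust_of_le_cnt hs ?_
  rw [cnt_eq, filter_true_of_mem, card_univ, Fintype.card_fin]
  intro i _
  have hlt : cnt univ (fun a => T ((univ.image (s i)).erase (s i a)) = 0) <
      (univ : Finset (Fin (d + 1))).card := by
    have := hT i
    rw [card_univ, Fintype.card_fin]; omega
  obtain ⟨a, ha⟩ : ∃ a, T ((univ.image (s i)).erase (s i a)) ≠ 0 := by
    by_contra hcon
    push Not at hcon
    rw [cnt_eq, filter_true_of_mem fun a _ => hcon a] at hlt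
    exact lt_irrefl _ hlt
  exact ⟨a.succAbove, Fin.succAbove_right_injective,
    by rwa [image_comp_succAbove (hs.uncurry_apply i)]⟩

theorem Robust.mono {R ι : Type*} [Zero R] [DecidableEq ι] {T : Finset ι → R} {d L L' : ℕ}
    (h : Robust T d L) (hL : L' ≤ L) : Robust T d L' := by
  obtain ⟨s, hs, hT⟩ := h
  refine ⟨fun i => s (Fin.castLE hL i), fun x y hxy => ?_, fun i => hT _⟩
  have h1 := @hs (_, _) (_, _) hxy
  exact Prod.ext (Fin.castLE_injective hL (congrArg Prod.fst h1)) (Prod.ext_iff.1 h1).2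

theorem RobustTriple.mono {R ι : Type*} [Zero R] [DecidableEq ι] {T : Finset ι → R} {d L L' : ℕ}
    (h : RobustTriple T d L) (hL : L' ≤ L) : RobustTriple T d L' := by
  obtain ⟨s, hs, hT⟩ := h
  refine ⟨fun i => s (Fin.castLE hL i), fun x y hxy => ?_, fun i => hT _⟩
  have h1 := @hs (_, _) (_, _) hxy
  exact Prod.ext (Fin.castLE_injective hL (Prod.ext_iff.1 h1).1) (Prod.ext_iff.1 h1).2

section Functionals
variable {R ι : Type*} [CommRing R] [DecidableEq ι] (T : Finset ι → R)

theorem lowFunctional_erase_of_ne {d : ℕ} {s : Fin d → ι} (hs : Function.Injective s)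
    {a b : Fin d} (hab : a ≠ b) : lowFunctional T ((univ.image s).erase (s a)) (s b) = 0 :=
  if_pos (mem_erase.2 ⟨hs.ne hab.symm, mem_image_of_mem _ (mem_univ _)⟩)

theorem lowFunctional_erase_self {d : ℕ} (s : Fin d → ι) (a : Fin d) :
    lowFunctional T ((univ.image s).erase (s a)) (s a) = T (univ.image s) := by
  rw [lowFunctional, if_neg (notMem_erase _ _),
    insert_erase (mem_image_of_mem _ (mem_univ _))]

/-- On the block, the functionals obtained by deleting pairs form a weighted edge-vertex incidence
matrix: the pair is an edge, and each endpoint carries the coefficient belonging to the other one.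
-/
theorem lowFunctional_erase_erase {d : ℕ} {s : Fin d → ι} (hs : Function.Injective s)
    {a b : Fin d} (hab : a ≠ b) (j : Fin d) :
    lowFunctional T (((univ.image s).erase (s a)).erase (s b)) (s j) =
      (if j = a then T ((univ.image s).erase (s b)) else 0) +
      (if j = b then T ((univ.image s).erase (s a)) else 0) := by
  have hm : ∀ j, s j ∈ univ.image s := fun j => mem_image_of_mem _ (mem_univ _)
  by_cases hja : j = a
  · subst hja
    rw [if_pos rfl, if_neg hab, add_zero, lowFunctional, if_neg (by simp), erase_right_comm,
      insert_erase (mem_erase.2 ⟨hs.ne hab, hm j⟩)]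
  by_cases hjb : j = b
  · subst hjb
    rw [if_pos rfl, if_neg hja, zero_add, lowFunctional, if_neg (by simp),
      insert_erase (mem_erase.2 ⟨hs.ne hja, hm j⟩)]
  rw [if_neg hja, if_neg hjb, add_zero, lowFunctional, if_pos]
  exact mem_erase.2 ⟨hs.ne hjb, mem_erase.2 ⟨hs.ne hja, hm j⟩⟩

end Functionals

theorem exists_three_of_cnt_add_two_le {d : ℕ} {P : Fin (d + 1) → Prop} (h : cnt univ P + 2 ≤ d) :
    ∃ a b c, a ≠ b ∧ a ≠ c ∧ b ≠ c ∧ ¬ P a ∧ ¬ P b ∧ ¬ P c := by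
  have h1 : 2 < (univ.filter fun a => ¬ P a).card := by
    have := card_filter_add_card_filter_not (s := (univ : Finset (Fin (d + 1)))) P
    rw [cnt_eq] at h
    rw [card_univ, Fintype.card_fin] at this
    omega
  obtain ⟨a, b, c, ha, hb, hc, hab, hac, hbc⟩ := two_lt_card_iff.1 h1
  exact ⟨a, b, c, hab, hac, hbc, (mem_filter.1 ha).2, (mem_filter.1 hb).2, (mem_filter.1 hc).2⟩

variable {p : ℕ} [Fact p.Prime] {m : ZMod p → ℝ} {β ρ : ℝ}

/-- The functionals from deleting one element of a `(d + 1)`-set are diagonal on that set with a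
nonzero diagonal, hence independent there. -/
theorem exists_le_pr_robust_low (hm : IsNondeg m β ρ) (d L : ℕ) {δ : ℝ} (hδ : 0 < δ) :
    ∃ N : ℕ, ∀ {ι : Type} [Fintype ι] [DecidableEq ι] (T : Finset ι → ZMod p),
      Robust T (d + 1) N →
      1 - ((p : ℝ) ^ (d + 1))⁻¹ - δ ≤ pr (wt m) (fun r => Robust (low r T) d L) := by
  obtain ⟨N, hN⟩ := exists_le_pr_card_exists_ne hm (d + 1) L hδ
  refine ⟨N, fun {ι} _ _ T hT => ?_⟩
  obtain ⟨s, hs, hT⟩ := hT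
  refine (hN (by simp) s hs (fun i a => lowFunctional T ((univ.image (s i)).erase (s i a)))
    fun i c hc => ?_).trans (pr_le_of_imp (isWeight_wt hm.isWeight) fun r hr =>
      robust_of_le_cnt hs (hr.trans (cnt_le_cnt subset_rfl fun i _ ⟨a, ha⟩ => ?_)))
  · obtain ⟨b, hb⟩ := Function.ne_iff.1 hc
    refine ⟨b, ?_⟩
    rw [sum_eq_single b, lowFunctional_erase_self]
    · exact mul_ne_zero hb (hT i)
    · intro a _ hab
      rw [lowFunctional_erase_of_ne T (hs.uncurry_apply i) hab, mul_zero]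
    · simp
  · refine ⟨a.succAbove, Fin.succAbove_right_injective, ?_⟩
    rwa [image_comp_succAbove (hs.uncurry_apply i), ← dotProduct_lowFunctional]

/-- Let `a`, `b`, `c` be positions whose deletion leaves a nonzero coefficient. The `d + 2` pairs
used are the star at `a` together with the edge `bc`, a connected graph with a single cycle, the
triangle `abc`. Since this cycle is odd, its weighted incidence matrix is invertible in odd
characteristic. -/
theorem exists_le_pr_robust_low_of_robustTriple (hm : IsNondeg m β ρ) (hp : 3 ≤ p) (d L : ℕ)
    {δ : ℝ} (hδ : 0 < δ) :
    ∃ N : ℕ, ∀ {ι : Type} [Fintype ι] [DecidableEq ι] (T : Finset ι → ZMod p),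
      RobustTriple T (d + 1) N →
      1 - ((p : ℝ) ^ (d + 2))⁻¹ - δ ≤ pr (wt m) (fun r => Robust (low r T) d L) := by
  obtain ⟨N, hN⟩ := exists_le_pr_card_exists_ne hm (d + 2) L hδ
  refine ⟨N, fun {ι} _ _ T hT => ?_⟩
  obtain ⟨s, hs, hT⟩ := hT
  choose a b c hab hac hbc ha hb hc using fun i => exists_three_of_cnt_add_two_le (hT i)
  let t : Fin N → Fin (d + 2) → ZMod p := fun i l => T ((univ.image (s i)).erase (s i l))
  -- Edge number `l` is `{a, l}`, except that the otherwise useless index `a` stands for `{b, c}`.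
  let f : Fin N → Fin (d + 2) → Fin (d + 2) := fun i l => if l = a i then b i else a i
  let g : Fin N → Fin (d + 2) → Fin (d + 2) := fun i l => if l = a i then c i else l
  have hfg : ∀ i l, f i l ≠ g i l := fun i l => by
    simp only [f, g]
    split_ifs with h
    · exact hbc i
    · exact fun h' => h h'.symm
  refine (hN (by simp) s hs (fun i l => lowFunctional T
    (((univ.image (s i)).erase (s i (f i l))).erase (s i (g i l))))
    fun i x hx => ?_).trans (pr_le_of_imp (isWeight_wt hm.isWeight) fun r hr =>
      robust_of_le_cnt hs (hr.trans (cnt_le_cnt subset_rfl fun i _ ⟨l, hl⟩ => ?_)))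
  · by_contra hcon
    push Not at hcon
    simp only [lowFunctional_erase_erase T (hs.uncurry_apply i) (hfg i _)] at hcon
    have hcon' : ∀ j, x (a i) * ((if j = b i then t i (c i) else 0) +
        (if j = c i then t i (b i) else 0)) + ∑ l ∈ univ.erase (a i),
        x l * ((if j = a i then t i l else 0) + (if j = l then t i (a i) else 0)) = 0 := by
      intro j
      refine Eq.trans ?_ (hcon j)
      rw [← add_sum_erase _ _ (mem_univ (a i))]
      congr 1
      · simp [f, g, t]
      · refine sum_congr rfl fun l hl => ?_
        simp [f, g, t, ne_of_mem_erase hl]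
    have h1 : ∀ j, j ≠ a i → x (a i) * ((if j = b i then t i (c i) else 0) +
        (if j = c i then t i (b i) else 0)) + x j * t i (a i) = 0 := fun j hj => by
      refine Eq.trans ?_ (hcon' j)
      congr 1
      rw [sum_eq_single j]
      · simp [hj]
      · intro l _ hl; simp [hj, hl.symm]
      · intro h; exact absurd (mem_erase.2 ⟨hj, mem_univ _⟩) h
    have h2 : ∑ l ∈ univ.erase (a i), x l * t i l = 0 := by
      have := hcon' (a i)
      rw [if_neg (hab i), if_neg (hac i)] at this
      simp only [if_true, add_zero, mul_zero, zero_add] at this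
      rw [← this]
      exact sum_congr rfl fun l hl => by rw [if_neg (ne_of_mem_erase hl).symm, add_zero]
    have ha' : t i (a i) ≠ 0 := ha i
    have hb' : t i (b i) ≠ 0 := hb i
    have hc' : t i (c i) ≠ 0 := hc i
    have h3 : ∀ j, j ≠ a i → j ≠ b i → j ≠ c i → x j = 0 := fun j hja hjb hjc => by
      have := h1 j hja
      rw [if_neg hjb, if_neg hjc, add_zero, mul_zero, zero_add] at this
      exact (mul_eq_zero.1 this).resolve_right ha'
    have h4 : x (a i) * t i (c i) + x (b i) * t i (a i) = 0 := by
      have := h1 (b i) (hab i).symm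
      rwa [if_pos rfl, if_neg (hbc i), add_zero] at this
    have h5 : x (a i) * t i (b i) + x (c i) * t i (a i) = 0 := by
      have := h1 (c i) (hac i).symm
      rwa [if_pos rfl, if_neg (hbc i).symm, zero_add] at this
    have h6 : x (b i) * t i (b i) + x (c i) * t i (c i) = 0 := by
      rw [← sum_pair (hbc i) (f := fun l => x l * t i l), ← h2]
      refine sum_subset (fun l hl => ?_) fun l hl hl' => ?_
      · rw [mem_insert, mem_singleton] at hl
        rcases hl with rfl | rfl
        · exact mem_erase.2 ⟨(hab i).symm, mem_univ _⟩
        · exact mem_erase.2 ⟨(hac i).symm, mem_univ _⟩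
      · rw [mem_insert, mem_singleton, not_or] at hl'
        rw [h3 l (ne_of_mem_erase hl) hl'.1 hl'.2, zero_mul]
    have htwo : (2 : ZMod p) ≠ 0 := by
      intro h
      have : ((2 : ℕ) : ZMod p) = 0 := by exact_mod_cast h
      rw [ZMod.natCast_eq_zero_iff] at this
      exact absurd (Nat.le_of_dvd two_pos this) (by omega)
    -- Going round the triangle adds the two contributions instead of cancelling them; this is where
    -- the factor 2 appears.
    have h7 : x (a i) = 0 := by
      have : 2 * t i (b i) * t i (c i) * x (a i) = 0 := by
        linear_combination (t i (b i)) * h4 + (t i (c i)) * h5 - (t i (a i)) * h6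
      exact (mul_eq_zero.1 this).resolve_left (mul_ne_zero (mul_ne_zero htwo hb') hc')
    rw [h7, zero_mul, zero_add] at h4 h5
    apply hx
    ext j
    by_cases hja : j = a i
    · rw [hja]; exact h7
    by_cases hjb : j = b i
    · rw [hjb]; exact (mul_eq_zero.1 h4).resolve_right ha'
    by_cases hjc : j = c i
    · rw [hjc]; exact (mul_eq_zero.1 h5).resolve_right ha'
    exact h3 j hja hjb hjc
  · obtain ⟨e, he⟩ := Fin.exists_succAbove_eq (hfg i l).symm
    refine ⟨(f i l).succAbove ∘ e.succAbove,
      Fin.succAbove_right_injective.comp Fin.succAbove_right_injective, ?_⟩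
    have hinj := (hs.uncurry_apply i)
    rw [← Function.comp_assoc,
      image_comp_succAbove (hinj.comp Fin.succAbove_right_injective),
      image_comp_succAbove hinj, Function.comp_apply, he, ← dotProduct_lowFunctional]
    exact hl

/-- Of the `d + 3` coefficients below a good set, at most `d` zeros leave at least three nonzero
ones. -/
theorem exists_le_pr_robustTriple_low (hm : IsNondeg m β ρ) (d L : ℕ) {δ : ℝ} (hδ : 0 < δ) :
    ∃ N : ℕ, ∀ {ι : Type} [Fintype ι] [DecidableEq ι] (T : Finset ι → ZMod p),
      Robust T (d + 3) N →
      1 - ((d : ℝ) + 3) / ((d + 1) * p) - δ ≤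
        pr (wt m) (fun r => RobustTriple (low r T) (d + 2) L) := by
  obtain ⟨N, hN⟩ := exists_fewZeros hm (d + 3) d L hδ _ ∅ rfl 0
  refine ⟨N, fun {ι} _ _ T hT => ?_⟩
  obtain ⟨s, hs, hT⟩ := hT
  have := hN (by simp) s hs (fun i a => lowFunctional T ((univ.image (s i)).erase (s i a)))
    (fun i a b hab => lowFunctional_erase_of_ne T (hs.uncurry_apply i) hab)
    (fun i a => by rw [lowFunctional_erase_self]; exact hT i) (by simp)
  push_cast at this
  refine this.trans (pr_le_of_imp (isWeight_wt hm.isWeight) fun r hr => ?_)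
  obtain ⟨f, hf, hP⟩ := exists_injective_of_le_cnt hr
  refine ⟨fun i => s (f i), fun x y hxy => ?_, fun i => ?_⟩
  · have h1 := @hs (_, _) (_, _) hxy
    exact Prod.ext (hf (congrArg Prod.fst h1)) (Prod.ext_iff.1 h1).2
  · have := hP i
    simp only [dotProduct_lowFunctional] at this
    exact Nat.add_le_add_right this 2

end Lowering

/-! ### Iterated contraction, permanents, and survival of a nonzero coefficient on few columns. -/

section Iterated
open scoped Classical
open Finset

/-- Successive contraction of a square-free form with the rows of a matrix. -/
def lows {R ι : Type*} [CommRing R] [Fintype ι] [DecidableEq ι] {k : ℕ} (A : Fin k → ι → R)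
    (T : Finset ι → R) : Finset ι → R :=
  (List.ofFn A).foldl (fun T r => low r T) T

/-- The product of all variables. -/
def topForm (R ι : Type*) [CommRing R] [Fintype ι] [DecidableEq ι] : Finset ι → R :=
  fun S => if S = univ then 1 else 0

section Algebra
variable {R ι : Type*} [CommRing R] [Fintype ι] [DecidableEq ι] {k : ℕ}

theorem lows_zero (A : Fin 0 → ι → R) (T : Finset ι → R) : lows A T = T := by simp [lows]

theorem lows_cons (r : ι → R) (A : Fin k → ι → R) (T : Finset ι → R) :
    lows (Fin.cons r A : Fin (k + 1) → ι → R) T = lows A (low r T) := by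
  simp [lows, List.ofFn_succ]

theorem lows_snoc (A : Fin k → ι → R) (r : ι → R) (T : Finset ι → R) :
    lows (Fin.snoc A r : Fin (k + 1) → ι → R) T = low r (lows A T) := by
  rw [lows, List.ofFn_succ_last]
  simp [lows]

theorem lows_apply (A : Fin k → ι → R) (T : Finset ι → R) (S : Finset ι) :
    lows A T S = ∑ f : Fin k → ι, if Function.Injective f ∧ ∀ i, f i ∉ S then
      (∏ i, A i (f i)) * T (S ∪ univ.image f) else 0 := by
  induction k generalizing T with
  | zero =>
    rw [lows_zero, Fintype.sum_subsingleton _ (fun i => i.elim0), if_pos]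
    · simp
    · exact ⟨Function.injective_of_subsingleton _, fun i => i.elim0⟩
  | succ k ih =>
    rw [← Fin.cons_self_tail A, lows_cons, ih,
      ← (Fin.consEquiv fun _ : Fin (k + 1) => ι).sum_comp, Fintype.sum_prod_type_right]
    refine sum_congr rfl fun f _ => ?_
    split_ifs with h
    · rw [low, mul_sum, ← sum_subset (subset_univ (S ∪ univ.image f)ᶜ)]
      · refine sum_congr rfl fun a ha => ?_
        simp only [mem_compl, mem_union, not_or, mem_image, mem_univ, true_and] at ha
        rw [if_pos]
        · simp only [Fin.consEquiv, Equiv.coe_fn_mk, Fin.prod_univ_succ, Fin.cons_zero,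
            Fin.cons_succ]
          have : S ∪ univ.image (Fin.cons a f : Fin (k + 1) → ι) =
              insert a (S ∪ univ.image f) := by
            ext x
            simp [Fin.exists_fin_succ, eq_comm]
            tauto
          rw [this]; ring
        · refine ⟨Fin.cons_injective_iff.2 ⟨fun hx => ha.2 hx, h.1⟩, fun i => ?_⟩
          refine Fin.cases ?_ (fun i => ?_) i
          · exact ha.1
          · exact h.2 i
      · intro a _ ha
        rw [if_neg]
        rintro ⟨h1, h2⟩
        simp only [mem_compl, not_not, mem_union, mem_image, mem_univ, true_and] at ha
        rcases ha with ha | ha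
        · exact h2 0 ha
        · exact (Fin.cons_injective_iff.1 h1).1 ha
    · symm
      refine sum_eq_zero fun a _ => if_neg ?_
      rintro ⟨h1, h2⟩
      exact h ⟨(Fin.cons_injective_iff.1 h1).2, fun i => h2 i.succ⟩

/-- Contracting the product of all variables with all rows gives the permanent. -/
theorem lows_topForm_eq_permanent {n : ℕ} (A : Matrix (Fin n) (Fin n) R) :
    lows (fun i j => A i j) (topForm R (Fin n)) ∅ = A.permanent := by
  rw [lows_apply, ← Matrix.permanent_transpose, Matrix.permanent]
  symm
  refine Fintype.sum_of_injective (fun σ : Equiv.Perm (Fin n) => (σ : Fin n → Fin n))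
    DFunLike.coe_injective _ _ (fun f hf => if_neg ?_) fun σ => ?_
  · rintro ⟨h, -⟩
    exact hf ⟨Equiv.ofBijective f (Finite.injective_iff_bijective.1 h), rfl⟩
  · rw [if_pos ⟨σ.injective, by simp⟩, empty_union, topForm, if_pos, mul_one]
    · rfl
    · exact image_univ_of_surjective σ.surjective

theorem card_of_low_ne_zero {r : ι → R} {T : Finset ι → R} {c : ℕ}
    (hT : ∀ S, T S ≠ 0 → S.card = c + 1) {S : Finset ι} (h : low r T S ≠ 0) : S.card = c := by
  obtain ⟨a, ha, hne⟩ := exists_ne_zero_of_sum_ne_zero h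
  have := hT _ (right_ne_zero_of_mul hne)
  rw [card_insert_of_notMem (mem_compl.1 ha)] at this
  omega

theorem card_of_lows_ne_zero {A : Fin k → ι → R} {T : Finset ι → R} {c : ℕ}
    (hT : ∀ S, T S ≠ 0 → S.card = c + k) {S : Finset ι} (h : lows A T S ≠ 0) : S.card = c := by
  induction k generalizing T with
  | zero => rw [lows_zero] at h; exact hT S h
  | succ k ih =>
    rw [← Fin.cons_self_tail A, lows_cons] at h
    exact ih (fun S hS => card_of_low_ne_zero (fun S h => (hT S h).trans (by omega)) hS) h

theorem card_of_lows_topForm_ne_zero {A : Fin k → ι → R} {d : ℕ} (hι : Fintype.card ι = k + d)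
    {S : Finset ι} (h : lows A (topForm R ι) S ≠ 0) : S.card = d := by
  refine card_of_lows_ne_zero (fun S hS => ?_) h
  have : S = univ := by
    by_contra hne
    exact hS (if_neg hne)
  rw [this, card_univ, hι, add_comm]

end Algebra

variable {p : ℕ} [Fact p.Prime] {m : ZMod p → ℝ} {β ρ : ℝ}

/-- It is unlikely that all coefficients obtained from `T S` by contraction in one of the
directions in `B` vanish. -/
theorem pr_low_erase_eq_zero_le (hm : IsNondeg m β ρ) {ι : Type*} [Fintype ι] [DecidableEq ι]
    {T : Finset ι → ZMod p} {S B : Finset ι} (hS : T S ≠ 0) (hB : B ⊆ S) :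
    pr (wt m) (fun r => ∀ a ∈ B, low r T (S.erase a) = 0) ≤ β ^ B.card := by
  have := pr_dotProduct_eq_le hm (σ := (Subtype.val : B → ι)) Subtype.val_injective
    (w := fun a => lowFunctional T (S.erase a))
    (fun a b hab => if_pos (mem_erase.2 ⟨fun h => hab (Subtype.ext h.symm), hB b.2⟩))
    (fun a => by
      rw [lowFunctional, if_neg (notMem_erase _ _), insert_erase (hB a.2)]; exact hS) 0
  simp only [dotProduct_lowFunctional, Fintype.card_coe] at this
  refine le_trans (le_of_eq (pr_congr fun r => ?_)) this
  simp

theorem pr_cons {α : Type*} [Fintype α] {w : α → ℝ} {k : ℕ} (B : (Fin (k + 1) → α) → Prop) :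
    pr (wt w) B = ev w (fun a => pr (wt w) (fun x : Fin k → α => B (Fin.cons a x))) :=
  ev_cons _

theorem pr_snoc {α : Type*} [Fintype α] {w : α → ℝ} {k : ℕ} (B : (Fin (k + 1) → α) → Prop) :
    pr (wt w) B = ev (wt w) (fun x : Fin k → α => pr w (fun a => B (Fin.snoc x a))) :=
  ev_snoc _

/-- A nonzero coefficient at `S` fails to pass to any `S.erase a` with probability at most `β ^
S.card`. Sets obtained by deletion stay inside `J`, so these failures just add up as the size
decreases from `D + c` to `D + 1`. -/
theorem pr_lows_eq_zero_le_of_subset (hm : IsNondeg m β ρ) {ι : Type*} [Fintype ι]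
    [DecidableEq ι] (J : Finset ι) (D c : ℕ) (T : Finset ι → ZMod p) (S : Finset ι)
    (hTS : T S ≠ 0) (hS : S.card = D + c) (hSJ : S ⊆ J) :
    pr (wt (wt m)) (fun A : Fin c → ι → ZMod p => ∀ S' ⊆ J, lows A T S' = 0) ≤
      ∑ j ∈ range c, β ^ (D + j + 1) := by
  have hW := isWeight_wt (ι := ι) hm.isWeight
  induction c generalizing T S with
  | zero =>
    simp only [lows_zero, range_zero, sum_empty]
    refine le_of_eq ?_
    rw [pr, ev]
    exact sum_eq_zero fun x _ => by rw [if_neg fun h => hTS (h S hSJ), mul_zero]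
  | succ c ih =>
    have hWc := isWeight_wt (ι := Fin c) hW
    rw [pr_cons, sum_range_succ]
    simp only [lows_cons]
    have key : ∀ r : ι → ZMod p, pr (wt (wt m)) (fun A : Fin c → ι → ZMod p =>
        ∀ S' ⊆ J, lows A (low r T) S' = 0) ≤ (∑ j ∈ range c, β ^ (D + j + 1)) +
          (if ∀ a ∈ S, low r T (S.erase a) = 0 then 1 else 0) := by
      intro r
      have hnn : 0 ≤ ∑ j ∈ range c, β ^ (D + j + 1) :=
        sum_nonneg fun _ _ => pow_nonneg hm.atom_nonneg _
      split_ifs with h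
      · exact (pr_le_one hWc _).trans (by linarith)
      · push Not at h
        obtain ⟨a, ha, hne⟩ := h
        rw [add_zero]
        exact ih _ _ hne (by rw [card_erase_of_mem ha, hS]; rfl) ((erase_subset _ _).trans hSJ)
    refine (ev_mono hW key).trans ?_
    rw [ev_add, ev_const hW, add_le_add_iff_left]
    refine (le_of_eq ?_).trans ((pr_low_erase_eq_zero_le hm hTS subset_rfl).trans_eq ?_)
    · rw [pr]; congr!
    · rw [hS, add_assoc]

/-- The growth constants in `pr_lows_eq_zero_le`. -/
noncomputable def growth (γ : ℝ) (l : ℕ) : ℝ :=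
  Real.exp (γ / ((1 - γ ^ 2) * (1 - γ)) * (1 - γ ^ (2 * l))) / γ ^ l

/-- Without the second summand, `γ ^ (-l)` would give equality. The exponential factor grows just
enough to absorb that summand, and stays bounded because the corrections form a geometric series. -/
theorem growth_succ {γ : ℝ} (h0 : 0 < γ) (h1 : γ < 1) (l : ℕ) :
    growth γ l + (γ ^ 2) ^ (l + 1) * growth γ (l + 1) ≤ growth γ (l + 1) * γ := by
  have hγ2 : 0 < 1 - γ ^ 2 := by nlinarith
  have hγ1 : 0 < 1 - γ := by linarith
  set κ := γ / ((1 - γ ^ 2) * (1 - γ)) with hκ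
  have hκ0 : 0 < κ := by positivity
  set y := γ ^ (2 * l) with hy
  have hy0 : 0 < y := by positivity
  have hy1 : y ≤ 1 := pow_le_one₀ h0.le h1.le
  set E := Real.exp (κ * (1 - γ ^ (2 * (l + 1)))) with hE
  have hE0 : 0 < E := Real.exp_pos _
  have h2 : Real.exp (κ * (1 - y)) * (1 + κ * (1 - γ ^ 2) * y) ≤ E := by
    have : E = Real.exp (κ * (1 - y)) * Real.exp (κ * (1 - γ ^ 2) * y) := by
      rw [← Real.exp_add, hE, hy, mul_add, pow_add]; congr 1; ring
    rw [this]
    refine mul_le_mul_of_nonneg_left ?_ (Real.exp_pos _).le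
    linarith [Real.add_one_le_exp (κ * (1 - γ ^ 2) * y)]
  have h3 : 1 ≤ (1 + κ * (1 - γ ^ 2) * y) * (1 - γ * y) := by
    have h4 : κ * (1 - γ ^ 2) * (1 - γ) = γ := by rw [hκ]; field_simp
    have h5 : 0 ≤ κ * (1 - γ ^ 2) * γ * (1 - y) * y := by
      have : 0 ≤ 1 - y := by linarith
      positivity
    have h6 : (1 + κ * (1 - γ ^ 2) * y) * (1 - γ * y) =
        1 + (κ * (1 - γ ^ 2) * (1 - γ) - γ) * y + κ * (1 - γ ^ 2) * γ * (1 - y) * y := by ring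
    rw [h6, h4]; linarith
  have hγy : 0 < 1 - γ * y := by nlinarith
  have h7 : Real.exp (κ * (1 - y)) ≤ E * (1 - γ * y) := by
    calc Real.exp (κ * (1 - y)) ≤
          Real.exp (κ * (1 - y)) * ((1 + κ * (1 - γ ^ 2) * y) * (1 - γ * y)) :=
          le_mul_of_one_le_right (Real.exp_pos _).le h3
      _ = (Real.exp (κ * (1 - y)) * (1 + κ * (1 - γ ^ 2) * y)) * (1 - γ * y) := by ring
      _ ≤ _ := mul_le_mul_of_nonneg_right h2 hγy.le
  have h8 : growth γ l = Real.exp (κ * (1 - y)) / γ ^ l := rfl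
  have h9 : growth γ (l + 1) = E / γ ^ (l + 1) := rfl
  rw [h8, h9, ← le_sub_iff_add_le]
  have h10 : E / γ ^ (l + 1) * γ - (γ ^ 2) ^ (l + 1) * (E / γ ^ (l + 1)) =
      E * (1 - γ * y) / γ ^ l := by
    rw [hy, pow_succ γ l, ← pow_mul]
    field_simp
    ring
  rw [h10]
  gcongr

theorem one_le_growth {γ : ℝ} (h0 : 0 < γ) (h1 : γ < 1) (l : ℕ) : 1 ≤ growth γ l := by
  have hγ2 : 0 < 1 - γ ^ 2 := by nlinarith
  have hγ1 : 0 < 1 - γ := by linarith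
  rw [growth, one_le_div (by positivity)]
  refine (pow_le_one₀ h0.le h1.le).trans (Real.one_le_exp ?_)
  have : 0 ≤ 1 - γ ^ (2 * l) := sub_nonneg.2 (pow_le_one₀ h0.le h1.le)
  positivity

theorem growth_mul_pow_le {γ : ℝ} (h0 : 0 < γ) (h1 : γ < 1) (l D : ℕ) :
    growth γ l * γ ^ (l + D) ≤ Real.exp (γ / ((1 - γ ^ 2) * (1 - γ))) * γ ^ D := by
  have hγ2 : 0 < 1 - γ ^ 2 := by nlinarith
  have hγ1 : 0 < 1 - γ := by linarith
  rw [growth, pow_add, ← mul_assoc, div_mul_cancel₀ _ (by positivity)]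
  gcongr
  have : 0 ≤ γ ^ (2 * l) := by positivity
  exact mul_le_of_le_one_right (by positivity) (by linarith)

/-- Each row should delete an element of `S` outside `J`, lowering `l`. This fails with probability
at most `(γ ^ 2) ^ l`; then an element of `J` is deleted and `l` is unchanged; failure of that too
is counted in the sum. The `growth` term bounds the risk of running out of rows before `S` lies in
`J`. -/
theorem pr_lows_eq_zero_le {γ : ℝ} (h0 : 0 < γ) (h1 : γ < 1) (hm : IsNondeg m (γ ^ 2) ρ)
    {ι : Type*} [Fintype ι] [DecidableEq ι] (J : Finset ι) (D c l : ℕ)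
    (T : Finset ι → ZMod p) (S : Finset ι) (hTS : T S ≠ 0) (hS : S.card = D + c)
    (hSJ : (S \ J).card = l) :
    pr (wt (wt m)) (fun A : Fin c → ι → ZMod p => ∀ S' ⊆ J, lows A T S' = 0) ≤
      growth γ l * γ ^ c + ∑ j ∈ range c, (γ ^ 2) ^ (D + j + 1) := by
  have hW := isWeight_wt (ι := ι) hm.isWeight
  induction c generalizing T S l with
  | zero =>
    refine (pr_le_one (isWeight_wt hW) _).trans ?_
    simpa using one_le_growth h0 h1 l
  | succ c ih =>
    have hWc := isWeight_wt (ι := Fin c) hW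
    have hg : ∀ l, 0 < growth γ l := fun l => one_pos.trans_le (one_le_growth h0 h1 l)
    have hγc : 0 < γ ^ c := pow_pos h0 c
    rcases l with _ | l
    · refine (pr_lows_eq_zero_le_of_subset hm J D (c + 1) T S hTS hS
        (sdiff_eq_empty_iff_subset.1 (card_eq_zero.1 hSJ))).trans ?_
      have := hg 0
      simp only [le_add_iff_nonneg_left]
      positivity
    rw [pr_cons, sum_range_succ]
    simp only [lows_cons]
    have key : ∀ r : ι → ZMod p, pr (wt (wt m)) (fun A : Fin c → ι → ZMod p =>
        ∀ S' ⊆ J, lows A (low r T) S' = 0) ≤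
          (growth γ l * γ ^ c + ∑ j ∈ range c, (γ ^ 2) ^ (D + j + 1)) +
          (growth γ (l + 1) * γ ^ c *
            (if ∀ a ∈ S \ J, low r T (S.erase a) = 0 then 1 else 0) +
          (if ∀ a ∈ S, low r T (S.erase a) = 0 then 1 else 0)) := by
      intro r
      have hnn : 0 ≤ ∑ j ∈ range c, (γ ^ 2) ^ (D + j + 1) :=
        sum_nonneg fun _ _ => by positivity
      have hgl := mul_pos (hg l) hγc
      have hgl' := mul_pos (hg (l + 1)) hγc
      by_cases hA : ∀ a ∈ S \ J, low r T (S.erase a) = 0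
      · rw [if_pos hA]
        split_ifs with h
        · exact (pr_le_one hWc _).trans (by linarith)
        · push Not at h
          obtain ⟨a, ha, hne⟩ := h
          have haJ : a ∈ J := by
            by_contra haJ
            exact hne (hA a (mem_sdiff.2 ⟨ha, haJ⟩))
          refine (ih (l + 1) _ _ hne (by rw [card_erase_of_mem ha, hS]; rfl) ?_).trans
            (by linarith)
          rw [erase_sdiff_comm, erase_eq_of_notMem (fun h => (mem_sdiff.1 h).2 haJ), hSJ]
      · rw [if_neg hA]
        push Not at hA
        obtain ⟨a, ha, hne⟩ := hA
        refine (ih l _ _ hne (by rw [card_erase_of_mem (mem_sdiff.1 ha).1, hS]; rfl) ?_).trans ?_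
        · rw [erase_sdiff_comm, card_erase_of_mem ha, hSJ]; rfl
        · rw [mul_zero, zero_add, le_add_iff_nonneg_right]
          split_ifs <;> norm_num
    refine (ev_mono hW key).trans ?_
    rw [ev_add, ev_const hW, ev_add, ev_const_mul]
    have e1 := pr_low_erase_eq_zero_le hm hTS (B := S \ J) sdiff_subset
    have e2 := pr_low_erase_eq_zero_le hm hTS (B := S) subset_rfl
    rw [hSJ] at e1
    rw [hS] at e2
    have e1' : ev (wt m) (fun r : ι → ZMod p => if ∀ a ∈ S \ J, low r T (S.erase a) = 0
        then (1 : ℝ) else 0) ≤ (γ ^ 2) ^ (l + 1) := by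
      refine le_trans (le_of_eq ?_) e1
      rw [pr]; congr!
    have e2' : ev (wt m) (fun r : ι → ZMod p => if ∀ a ∈ S, low r T (S.erase a) = 0
        then (1 : ℝ) else 0) ≤ (γ ^ 2) ^ (D + c + 1) := by
      refine le_trans (le_of_eq ?_) e2
      rw [pr]; congr!
    have e3 := mul_le_mul_of_nonneg_left e1' (mul_pos (hg (l + 1)) hγc).le
    have e4 := mul_le_mul_of_nonneg_right (growth_succ h0 h1 l) hγc.le
    rw [pow_succ γ c]
    nlinarith

/-- The form obtained from the first rows of a random matrix is nonzero on a given set of columns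
with high probability. -/
theorem pr_lows_topForm_eq_zero_le {γ : ℝ} (h0 : 0 < γ) (h1 : γ < 1) (hm : IsNondeg m (γ ^ 2) ρ)
    {ι : Type*} [Fintype ι] [DecidableEq ι] (J : Finset ι) {D k : ℕ} (hDk : D ≤ k)
    (hι : Fintype.card ι = k + D) (hJ : J.card = 2 * D) :
    pr (wt (wt m)) (fun A : Fin k → ι → ZMod p =>
      ∀ S ⊆ J, lows A (topForm (ZMod p) ι) S = 0) ≤
      Real.exp (γ / ((1 - γ ^ 2) * (1 - γ))) * γ ^ D + (γ ^ 2) ^ D / (1 - γ ^ 2) := by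
  refine (pr_lows_eq_zero_le h0 h1 hm J D k (k - D) (topForm (ZMod p) ι) univ
    (by simp [topForm]) (by rw [card_univ, hι, add_comm]) ?_).trans (add_le_add ?_ ?_)
  · rw [← compl_eq_univ_sdiff, card_compl, hι, hJ]; omega
  · have := growth_mul_pow_le h0 h1 (k - D) D
    rwa [Nat.sub_add_cancel hDk] at this
  · have hγ2 : γ ^ 2 < 1 := by nlinarith
    have hγ2' : 0 ≤ γ ^ 2 := by positivity
    have h2 : ∑ j ∈ range k, (γ ^ 2) ^ (D + j + 1) ≤
        (γ ^ 2) ^ D * ∑ j ∈ range k, (γ ^ 2) ^ j := by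
      rw [mul_sum]
      refine sum_le_sum fun j _ => ?_
      rw [← pow_add]
      exact pow_le_pow_of_le_one hγ2' hγ2.le (by omega)
    refine h2.trans ?_
    rw [div_eq_mul_inv]
    refine mul_le_mul_of_nonneg_left ?_ (by positivity)
    rw [← tsum_geometric_of_lt_one hγ2' hγ2]
    exact (summable_geometric_of_lt_one hγ2' hγ2).sum_le_tsum _ fun _ _ => by positivity

end Iterated

/-! ### Limiting lower bounds for robustness, degree by degree, and the last row. -/

section Asymptotic
open scoped Classical
open Finset

variable {p : ℕ} [Fact p.Prime] {m : ZMod p → ℝ} {β ρ : ℝ}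

/-- After all but `d` rows, the form is robustly nonzero with probability asymptotically at
least `x`. -/
def RobustBound (m : ZMod p → ℝ) (d : ℕ) (x : ℝ) : Prop :=
  ∀ L : ℕ, ∀ δ : ℝ, 0 < δ → ∃ k₀ : ℕ, ∀ k ≥ k₀, ∀ {ι : Type} [Fintype ι] [DecidableEq ι],
    Fintype.card ι = k + d → x - δ ≤ pr (wt (wt m))
      (fun A : Fin k → ι → ZMod p => Robust (lows A (topForm (ZMod p) ι)) d L)

/-- The analogue of `RobustBound` for `RobustTriple`. -/
def TripleBound (m : ZMod p → ℝ) (d : ℕ) (x : ℝ) : Prop :=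
  ∀ L : ℕ, ∀ δ : ℝ, 0 < δ → ∃ k₀ : ℕ, ∀ k ≥ k₀, ∀ {ι : Type} [Fintype ι] [DecidableEq ι],
    Fintype.card ι = k + d → x - δ ≤ pr (wt (wt m))
      (fun A : Fin k → ι → ZMod p => RobustTriple (lows A (topForm (ZMod p) ι)) d L)

theorem RobustBound.mono {d : ℕ} {x y : ℝ} (h : RobustBound m d x) (hy : y ≤ x) :
    RobustBound m d y := fun L δ hδ =>
  (h L δ hδ).imp fun _ hk k hkk _ _ _ hι => (by linarith : y - δ ≤ x - δ).trans (hk k hkk hι)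

theorem RobustBound.of_forall_sub {d : ℕ} {x : ℝ} (h : ∀ ε > 0, RobustBound m d (x - ε)) :
    RobustBound m d x := fun L δ hδ =>
  (h (δ / 2) (half_pos hδ) L (δ / 2) (half_pos hδ)).imp fun _ hk k hkk _ _ _ hι =>
    (by linarith : x - δ ≤ x - δ / 2 - δ / 2).trans (hk k hkk hι)

theorem tripleBound_zero (hm : IsNondeg m β ρ) (d : ℕ) : TripleBound m d 0 :=
  fun L δ hδ => ⟨0, fun k _ ι _ _ _ =>
    (by linarith : 0 - δ ≤ 0).trans (pr_nonneg (isWeight_wt (isWeight_wt hm.isWeight)) _)⟩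

theorem robustBound_of_pr_le (hm : IsNondeg m β ρ) {D : ℕ} {η : ℝ}
    (h : ∀ k ≥ D, ∀ {ι : Type} [Fintype ι] [DecidableEq ι], Fintype.card ι = k + D →
      ∀ J : Finset ι, J.card = 2 * D → pr (wt (wt m)) (fun A : Fin k → ι → ZMod p =>
        ∀ S ⊆ J, lows A (topForm (ZMod p) ι) S = 0) ≤ η) : RobustBound m D (1 - η) := by
  intro L δ hδ
  obtain ⟨N, hN0, hN⟩ := exists_div_le L hδ
  -- Enough columns for `N` disjoint sets of size `2 * D`.
  refine ⟨max D (N * (2 * D)), fun k hk ι _ _ hι => ?_⟩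
  have hW := isWeight_wt (ι := Fin k) (isWeight_wt (ι := ι) hm.isWeight)
  obtain ⟨σ⟩ := Function.Embedding.nonempty_of_card_le (α := Fin N × Fin (2 * D)) (β := ι) (by
    simp only [Fintype.card_prod, Fintype.card_fin, hι]
    exact ((le_max_right _ _).trans hk).trans (Nat.le_add_right _ _))
  let s : Fin N → Fin (2 * D) → ι := fun i j => σ (i, j)
  have hs : Function.Injective (Function.uncurry s) := σ.injective
  have h1 := le_pr_card_filter hW (univ : Finset (Fin N)) ⟨⟨0, hN0⟩, mem_univ _⟩
    (fun i A => ¬ ∀ S ⊆ univ.image (s i), lows A (topForm (ZMod p) ι) S = 0) (1 - η) L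
    (fun i _ => by
      rw [pr_not hW]
      have := h k ((le_max_left _ _).trans hk) hι (univ.image (s i)) (by
        rw [card_image_of_injective _ (hs.uncurry_apply i), card_univ, Fintype.card_fin])
      linarith)
  rw [card_univ, Fintype.card_fin] at h1
  refine le_trans (by linarith [hN N le_rfl]) (h1.trans (pr_le_of_imp hW fun A hA =>
    robust_of_le_cnt hs (hA.trans (cnt_le_cnt subset_rfl fun i _ hi => ?_))))
  push Not at hi
  obtain ⟨S, hSJ, hne⟩ := hi
  have hSc := card_of_lows_topForm_ne_zero hι hne
  set Q : Finset (Fin (2 * D)) := univ.filter fun j => s i j ∈ S with hQ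
  have hQS : Q.image (s i) = S := by
    ext x
    simp only [hQ, mem_image, mem_filter, mem_univ, true_and]
    constructor
    · rintro ⟨j, hj, rfl⟩; exact hj
    · intro hx
      obtain ⟨j, -, rfl⟩ := mem_image.1 (hSJ hx)
      exact ⟨j, hx, rfl⟩
  have hQc : Q.card = D := (card_image_of_injective Q (hs.uncurry_apply i)).symm.trans
    ((congrArg card hQS).trans hSc)
  refine ⟨Q.orderEmbOfFin hQc, (Q.orderEmbOfFin hQc).injective, ?_⟩
  rw [← image_image, image_orderEmbOfFin_univ, hQS]
  exact hne

theorem IsNondeg.mono (hm : IsNondeg m β ρ) {β' : ℝ} (h : β ≤ β') (h1 : β' < 1) :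
    IsNondeg m β' ρ :=
  { hm with le_atom := fun x => (hm.le_atom x).trans h, lt_one := h1 }

theorem exists_robustBound (hm : IsNondeg m β ρ) {ε : ℝ} (hε : 0 < ε) :
    ∃ D₀, ∀ D ≥ D₀, RobustBound m D (1 - ε) := by
  have hβ0 := hm.atom_nonneg
  have hβ1 := hm.lt_one
  -- Any `γ` in `(0, 1)` with `β ≤ γ ^ 2` would do.
  set γ := Real.sqrt ((1 + β) / 2) with hγ
  have hγ2 : γ ^ 2 = (1 + β) / 2 := Real.sq_sqrt (by linarith)
  have h0 : 0 < γ := Real.sqrt_pos.2 (by linarith)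
  have h1 : γ < 1 := by
    rw [hγ, Real.sqrt_lt' one_pos]; linarith
  have hm' : IsNondeg m (γ ^ 2) ρ := hm.mono (by rw [hγ2]; linarith) (by rw [hγ2]; linarith)
  have hlim : Tendsto (fun D : ℕ => Real.exp (γ / ((1 - γ ^ 2) * (1 - γ))) * γ ^ D +
      (γ ^ 2) ^ D / (1 - γ ^ 2)) atTop (nhds (Real.exp (γ / ((1 - γ ^ 2) * (1 - γ))) * 0 +
        0 / (1 - γ ^ 2))) :=
    ((tendsto_pow_atTop_nhds_zero_of_lt_one h0.le h1).const_mul _).add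
      ((tendsto_pow_atTop_nhds_zero_of_lt_one (by positivity) hm'.lt_one).div_const _)
  rw [mul_zero, zero_div, add_zero] at hlim
  obtain ⟨D₀, hD⟩ := eventually_atTop.1 (hlim.eventually_le_const hε)
  exact ⟨D₀, fun D hDD => robustBound_of_pr_le hm fun k hk ι _ _ hι J hJ =>
    (pr_lows_topForm_eq_zero_le h0 h1 hm' J hk hι hJ).trans (hD D hDD)⟩

theorem inv_pow_le_one (d : ℕ) : ((p : ℝ) ^ d)⁻¹ ≤ 1 :=
  inv_le_one_of_one_le₀ (one_le_pow₀ (by exact_mod_cast (Fact.out : p.Prime).one_lt.le))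

/-- Adding one row, taking into account that the form may be robustly of large rank. -/
theorem RobustBound.step_of_tripleBound (hm : IsNondeg m β ρ) (hp : 3 ≤ p) {d : ℕ} {x y : ℝ}
    (hx : RobustBound m (d + 1) x) (hy : TripleBound m (d + 1) y) :
    RobustBound m d (x * (1 - ((p : ℝ) ^ (d + 1))⁻¹) +
      y * (((p : ℝ) ^ (d + 1))⁻¹ - ((p : ℝ) ^ (d + 2))⁻¹)) := by
  intro L δ hδ
  have hδ3 : 0 < δ / 3 := by positivity
  set q := ((p : ℝ) ^ (d + 1))⁻¹ with hq
  set q' := ((p : ℝ) ^ (d + 2))⁻¹ with hq'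
  have hq0 : 0 ≤ q := by positivity
  have hq1 : q ≤ 1 := inv_pow_le_one _
  have hq'0 : 0 ≤ q' := by positivity
  have hqq' : q' ≤ q := by
    refine inv_anti₀ (pow_pos (by exact_mod_cast (NeZero.pos p)) _) ?_
    exact pow_le_pow_right₀ (by exact_mod_cast (Fact.out : p.Prime).one_lt.le) (by omega)
  obtain ⟨N₁, hN₁⟩ := exists_le_pr_robust_low hm d L hδ3
  obtain ⟨N₂, hN₂⟩ := exists_le_pr_robust_low_of_robustTriple hm hp d L hδ3
  set N := max N₁ N₂
  obtain ⟨k₁, hk₁⟩ := hx N (δ / 3) hδ3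
  obtain ⟨k₂, hk₂⟩ := hy N (δ / 3) hδ3
  refine ⟨max k₁ k₂ + 1, fun k hk ι _ _ hι => ?_⟩
  obtain ⟨k, rfl⟩ : ∃ k', k = k' + 1 := ⟨k - 1, by omega⟩
  have hk' : max k₁ k₂ ≤ k := by omega
  have hι' : Fintype.card ι = k + (d + 1) := by omega
  have e1 := hk₁ k ((le_max_left _ _).trans hk') hι'
  have e2 := hk₂ k ((le_max_right _ _).trans hk') hι'
  have hW := isWeight_wt (ι := ι) hm.isWeight
  have hWk := isWeight_wt (ι := Fin k) hW
  set PR := fun A : Fin k → ι → ZMod p => Robust (lows A (topForm (ZMod p) ι)) (d + 1) N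
  set PT := fun A : Fin k → ι → ZMod p => RobustTriple (lows A (topForm (ZMod p) ι)) (d + 1) N
  -- As `PT` implies `PR`, its better success probability `1 - q'` enters as a bonus `q - q'` on top
  -- of `1 - q`.
  have e3 : ∀ A : Fin k → ι → ZMod p, (1 - q - δ / 3) * (if PR A then 1 else 0) +
      (q - q') * (if PT A then 1 else 0) ≤ pr (wt m) (fun r => Robust
        (lows (Fin.snoc A r : Fin (k + 1) → ι → ZMod p) (topForm (ZMod p) ι)) d L) := by
    intro A
    simp only [lows_snoc]
    by_cases hT : PT A
    · have hR : PR A := RobustTriple.robust hT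
      rw [if_pos hT, if_pos hR]
      exact le_trans (by linarith) (hN₂ _ (RobustTriple.mono hT (le_max_right _ _)))
    · rw [if_neg hT, mul_zero, add_zero]
      by_cases hR : PR A
      · rw [if_pos hR]
        exact le_trans (by linarith) (hN₁ _ (Robust.mono hR (le_max_left _ _)))
      · rw [if_neg hR, mul_zero]
        exact pr_nonneg hW _
  rw [pr_snoc]
  refine le_trans ?_ (ev_mono hWk e3)
  rw [ev_add, ev_const_mul, ev_const_mul]
  change _ ≤ (1 - q - δ / 3) * pr (wt (wt m)) PR + (q - q') * pr (wt (wt m)) PT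
  have e4 := pr_le_one hWk PR
  have e5 : (1 - q) * (x - δ / 3) ≤ (1 - q) * pr (wt (wt m)) PR :=
    mul_le_mul_of_nonneg_left e1 (by linarith)
  have e6 : (q - q') * (y - δ / 3) ≤ (q - q') * pr (wt (wt m)) PT :=
    mul_le_mul_of_nonneg_left e2 (by linarith)
  nlinarith

theorem RobustBound.step (hm : IsNondeg m β ρ) (hp : 3 ≤ p) {d : ℕ} {x : ℝ}
    (hx : RobustBound m (d + 1) x) : RobustBound m d (x * (1 - ((p : ℝ) ^ (d + 1))⁻¹)) := by
  have := hx.step_of_tripleBound hm hp (tripleBound_zero hm _)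
  rwa [zero_mul, add_zero] at this

theorem RobustBound.tripleBound (hm : IsNondeg m β ρ) {d : ℕ} {x : ℝ}
    (hx : RobustBound m (d + 3) x) (hd : ((d : ℝ) + 3) / ((d + 1) * p) ≤ 1) :
    TripleBound m (d + 2) (x * (1 - ((d : ℝ) + 3) / ((d + 1) * p))) := by
  intro L δ hδ
  set q := ((d : ℝ) + 3) / ((d + 1) * p) with hq
  have hq0 : 0 ≤ q := by positivity
  obtain ⟨N, hN⟩ := exists_le_pr_robustTriple_low hm d L (half_pos hδ)
  obtain ⟨k₁, hk₁⟩ := hx N (δ / 2) (half_pos hδ)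
  refine ⟨k₁ + 1, fun k hk ι _ _ hι => ?_⟩
  obtain ⟨k, rfl⟩ : ∃ k', k = k' + 1 := ⟨k - 1, by omega⟩
  have e1 := hk₁ k (by omega) (show Fintype.card ι = k + (d + 3) by omega)
  have hW := isWeight_wt (ι := ι) hm.isWeight
  have hWk := isWeight_wt (ι := Fin k) hW
  set PR := fun A : Fin k → ι → ZMod p => Robust (lows A (topForm (ZMod p) ι)) (d + 3) N
  have e3 : ∀ A : Fin k → ι → ZMod p, (1 - q - δ / 2) * (if PR A then 1 else 0) ≤
      pr (wt m) (fun r => RobustTriple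
        (lows (Fin.snoc A r : Fin (k + 1) → ι → ZMod p) (topForm (ZMod p) ι)) (d + 2) L) := by
    intro A
    simp only [lows_snoc]
    by_cases hR : PR A
    · rw [if_pos hR, mul_one]
      exact hN _ hR
    · rw [if_neg hR, mul_zero]
      exact pr_nonneg hW _
  rw [pr_snoc]
  refine le_trans ?_ (ev_mono hWk e3)
  rw [ev_const_mul]
  change _ ≤ (1 - q - δ / 2) * pr (wt (wt m)) PR
  have e4 := pr_le_one hWk PR
  have e5 : (1 - q) * (x - δ / 2) ≤ (1 - q) * pr (wt (wt m)) PR :=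
    mul_le_mul_of_nonneg_left e1 (by linarith)
  nlinarith

theorem RobustBound.steps (hm : IsNondeg m β ρ) (hp : 3 ≤ p) (n : ℕ) {d : ℕ} {x : ℝ}
    (hx : RobustBound m (d + n) x) :
    RobustBound m d (x * ∏ j ∈ range n, (1 - ((p : ℝ) ^ (d + j + 1))⁻¹)) := by
  induction n generalizing x with
  | zero => simpa using hx
  | succ n ih =>
    have := ih (show RobustBound m (d + n) (x * (1 - ((p : ℝ) ^ (d + n + 1))⁻¹)) from
      RobustBound.step hm hp hx)
    rw [prod_range_succ]
    convert this using 1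
    ring

/-- Descend from a degree high enough for robustness to hold up to `ε`; the losses multiply to a
partial product, and `ε` is arbitrary. -/
theorem robustBound_of_le_prod (hm : IsNondeg m β ρ) (hp : 3 ≤ p) {d : ℕ} {x : ℝ}
    (hx : ∀ n, x ≤ ∏ j ∈ range n, (1 - ((p : ℝ) ^ (d + j + 1))⁻¹)) : RobustBound m d x := by
  refine .of_forall_sub fun ε hε => ?_
  obtain ⟨D, hD⟩ := exists_robustBound hm hε
  refine ((hD (d + D) (by omega)).steps hm hp D).mono ?_
  have h0 : ∀ j, (0 : ℝ) ≤ 1 - ((p : ℝ) ^ (d + j + 1))⁻¹ := fun j =>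
    sub_nonneg.2 (inv_pow_le_one _)
  have h1 : ∏ j ∈ range D, (1 - ((p : ℝ) ^ (d + j + 1))⁻¹) ≤ 1 :=
    prod_le_one (fun j _ => h0 j) fun j _ => sub_le_self _ (by positivity)
  nlinarith [hx D]

/-- The distribution of the permanent, in terms of the probability that the form obtained from all
rows but the last one is robustly nonzero. -/
theorem RobustBound.permanent (hm : IsNondeg m β ρ) {x : ℝ} (hx : RobustBound m 1 x) {δ : ℝ}
    (hδ : 0 < δ) : ∃ n₀, ∀ n ≥ n₀, ∀ z : ZMod p,
      x / p - δ ≤ pr (wt (wt m)) (fun A : Fin n → Fin n → ZMod p =>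
        Matrix.permanent (Matrix.of A) = z) ∧
      pr (wt (wt m)) (fun A : Fin n → Fin n → ZMod p => Matrix.permanent (Matrix.of A) = z) ≤
        1 - x * (1 - 1 / p) + δ := by
  obtain ⟨L, hL⟩ := exists_pow_le_of_lt_one hm.fourier_lt_one (half_pos hδ)
  obtain ⟨k₁, hk₁⟩ := hx L (δ / 2) (half_pos hδ)
  refine ⟨k₁ + 1, fun n hn z => ?_⟩
  obtain ⟨k, rfl⟩ : ∃ k', n = k' + 1 := ⟨n - 1, by omega⟩
  have e1 := hk₁ k (by omega) (show Fintype.card (Fin (k + 1)) = k + 1 by simp)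
  have hW := isWeight_wt (ι := Fin (k + 1)) hm.isWeight
  have hWk := isWeight_wt (ι := Fin k) hW
  set PR := fun A : Fin k → Fin (k + 1) → ZMod p =>
    Robust (lows A (topForm (ZMod p) (Fin (k + 1)))) 1 L
  have hper : ∀ A : Fin (k + 1) → Fin (k + 1) → ZMod p, Matrix.permanent (Matrix.of A) = z ↔
      lows A (topForm (ZMod p) (Fin (k + 1))) ∅ = z := fun A => by
    rw [← lows_topForm_eq_permanent]; rfl
  have hPR : ∀ A, PR A → |pr (wt m) (fun r => lows (Fin.snoc A r : Fin (k + 1) → _ → ZMod p)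
      (topForm (ZMod p) (Fin (k + 1))) ∅ = z) - 1 / p| ≤ δ / 2 := by
    rintro A ⟨s, hs, hT⟩
    simp only [lows_snoc, ← dotProduct_lowFunctional]
    set T := lows A (topForm (ZMod p) (Fin (k + 1)))
    have := abs_pr_dotProduct_eq_sub_le hm (κ := Unit) (fun _ => lowFunctional T ∅) L
      (fun c hc => by
        have hc' : c () ≠ 0 := fun h => hc (by ext; simpa using h)
        have hinj : Function.Injective (fun i => s i 0) := fun i j hij =>
          congrArg Prod.fst (@hs (i, 0) (j, 0) hij)
        have h1 : cnt (univ : Finset (Fin L)) (fun _ => True) = L := by simp [cnt]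
        refine h1.symm.le.trans (cnt_le_cnt_of_injective hinj fun i _ => ?_)
        have := hT i
        rw [univ_unique, image_singleton] at this
        simpa [lowFunctional, hc'] using this)
      (fun _ => z)
    simp only [forall_const, Fintype.card_unit, pow_one] at this
    rw [one_div]
    exact this.trans hL
  simp only [hper]
  rw [pr_snoc]
  have hp0 : (0 : ℝ) ≤ 1 / p := by positivity
  have hp1 : (1 : ℝ) / p ≤ 1 := by
    have := inv_pow_le_one (p := p) 1
    rwa [pow_one, ← one_div] at this
  have e4 := pr_le_one hWk PR
  have e5 := pr_nonneg hWk PR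
  constructor
  · have e3 : ∀ A, (1 / p - δ / 2) * (if PR A then 1 else 0) ≤ pr (wt m) (fun r =>
        lows (Fin.snoc A r : Fin (k + 1) → _ → ZMod p) (topForm (ZMod p) (Fin (k + 1))) ∅ = z) := by
      intro A
      split_ifs with h
      · have := (abs_le.1 (hPR A h)).1
        linarith
      · rw [mul_zero]; exact pr_nonneg hW _
    refine le_trans ?_ (ev_mono hWk e3)
    rw [ev_const_mul]
    change _ ≤ (1 / (p : ℝ) - δ / 2) * pr (wt (wt m)) PR
    have e6 : 1 / (p : ℝ) * (x - δ / 2) ≤ 1 / p * pr (wt (wt m)) PR :=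
      mul_le_mul_of_nonneg_left e1 hp0
    have e7 : x / p = 1 / p * x := by ring
    rw [e7]
    nlinarith
  -- Where robustness fails only the trivial bound 1 is available, since the form may vanish there.
  · have e3 : ∀ A, pr (wt m) (fun r => lows (Fin.snoc A r : Fin (k + 1) → _ → ZMod p)
        (topForm (ZMod p) (Fin (k + 1))) ∅ = z) ≤
          1 - (1 - 1 / p - δ / 2) * (if PR A then 1 else 0) := by
      intro A
      split_ifs with h
      · have := (abs_le.1 (hPR A h)).2
        linarith
      · rw [mul_zero, sub_zero]; exact pr_le_one hW _
    refine (ev_mono hWk e3).trans ?_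
    rw [ev_sub, ev_const hWk, ev_const_mul]
    change 1 - (1 - 1 / (p : ℝ) - δ / 2) * pr (wt (wt m)) PR ≤ _
    have e6 : (1 - 1 / (p : ℝ)) * (x - δ / 2) ≤ (1 - 1 / p) * pr (wt (wt m)) PR :=
      mul_le_mul_of_nonneg_left e1 (by linarith)
    nlinarith

end Asymptotic

/-! ### From random matrices on probability spaces to finite weights. -/

section Transfer
open scoped Classical
open Finset

variable {p : ℕ} [Fact p.Prime]

theorem isWeight_toReal (μ : PMF (ZMod p)) : IsWeight (fun x => (μ x).toReal) where
  nonneg x := ENNReal.toReal_nonneg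
  sum_eq_one := by
    rw [← ENNReal.toReal_sum fun x _ => μ.apply_ne_top x, ← tsum_fintype (L := .unconditional _),
      μ.tsum_coe, ENNReal.toReal_one]

theorem exists_lt_one_forall_le {α : Type*} [Finite α] [Nonempty α] {f : α → ℝ}
    (h : ∀ x, f x < 1) : ∃ b < 1, ∀ x, f x ≤ b := by
  obtain ⟨x, hx⟩ := Finite.exists_max f
  exact ⟨f x, h x, hx⟩

/-- Two points of the support give summands of different arguments in every nontrivial Fourier
coefficient, so the triangle inequality is strict; finiteness makes the bounds uniform. -/
theorem exists_isNondeg (μ : PMF (ZMod p)) (hμ : μ.support.Nontrivial) :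
    ∃ β ρ, IsNondeg (fun x => (μ x).toReal) β ρ := by
  have hw := isWeight_toReal μ
  have hpos : ∀ x ∈ μ.support, 0 < (μ x).toReal := fun x hx =>
    ENNReal.toReal_pos ((μ.mem_support_iff x).1 hx) (μ.apply_ne_top x)
  obtain ⟨u, hu, v, hv, huv⟩ := hμ
  set m : ZMod p → ℝ := fun x => (μ x).toReal
  have hsum : ∀ (s : Finset (ZMod p)), ∑ x ∈ s, m x + ∑ x ∈ sᶜ, m x = 1 := fun s => by
    rw [sum_add_sum_compl, hw.sum_eq_one]
  obtain ⟨β, hβ1, hβ⟩ := exists_lt_one_forall_le (f := m) (fun x => by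
    obtain ⟨y, hy, hyx⟩ : ∃ y ∈ μ.support, y ≠ x := by
      by_cases h : u = x
      · exact ⟨v, hv, fun h' => huv (h.trans h'.symm)⟩
      · exact ⟨u, hu, h⟩
    have h1 := hsum {x}
    rw [sum_singleton] at h1
    have h2 : m y ≤ ∑ x ∈ {x}ᶜ, m x :=
      single_le_sum (fun x _ => hw.nonneg x) (by simpa using hyx)
    linarith [hpos y hy])
  obtain ⟨ρ, hρ1, hρ⟩ := exists_lt_one_forall_le (α := ZMod p)
    (f := fun a => if a = 0 then 0 else ‖∑ x, (m x : ℂ) * ZMod.stdAddChar (a * x)‖) (fun a => by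
      split_ifs with ha
      · exact one_pos
      have hnorm : ∀ x, ‖(m x : ℂ) * ZMod.stdAddChar (a * x)‖ = m x := fun x => by
        rw [norm_mul, AddChar.norm_apply, mul_one, Complex.norm_real,
          Real.norm_of_nonneg (hw.nonneg x)]
      have hray : ¬ SameRay ℝ ((m u : ℂ) * ZMod.stdAddChar (a * u))
          ((m v : ℂ) * ZMod.stdAddChar (a * v)) := by
        have hu0 := (hpos u hu).ne'
        have hv0 := (hpos v hv).ne'
        have hne : ∀ x, m x ≠ 0 → (m x : ℂ) * ZMod.stdAddChar (a * x) ≠ 0 := fun x hx => by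
          rw [← norm_ne_zero_iff, hnorm]; exact hx
        rw [sameRay_iff_inv_norm_smul_eq_of_ne (hne u hu0) (hne v hv0), hnorm, hnorm,
          Complex.real_smul, Complex.real_smul, ← mul_assoc, ← mul_assoc, Complex.ofReal_inv,
          Complex.ofReal_inv, inv_mul_cancel₀ (Complex.ofReal_ne_zero.2 hu0),
          inv_mul_cancel₀ (Complex.ofReal_ne_zero.2 hv0), one_mul, one_mul]
        intro h
        exact huv (mul_left_cancel₀ ha (ZMod.injective_stdAddChar h))
      rw [← add_sum_erase _ _ (mem_univ u),
        ← add_sum_erase _ _ (mem_erase.2 ⟨huv.symm, mem_univ v⟩), ← add_assoc]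
      have h1 := norm_add_lt_of_not_sameRay hray
      have h2 := norm_sum_le ((univ.erase u).erase v)
        (fun x => (m x : ℂ) * ZMod.stdAddChar (a * x))
      have h3 := hw.sum_eq_one
      rw [← add_sum_erase _ _ (mem_univ u),
        ← add_sum_erase _ _ (mem_erase.2 ⟨huv.symm, mem_univ v⟩)] at h3
      simp only [hnorm] at h1 h2
      exact (norm_add_le _ _).trans_lt (by linarith))
  refine ⟨β, ρ, hw, hβ, hβ1, ?_, hρ1, fun a ha => ?_⟩
  · simpa using hρ 0
  · simpa [ha] using hρ a

theorem measureReal_eq_pr {Ω : Type*} [MeasurableSpace Ω] {P : Measure Ω} [IsProbabilityMeasure P]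
    {n : ℕ} {A : Ω → Matrix (Fin n) (Fin n) (ZMod p)} {μ : PMF (ZMod p)}
    (h : IsIIDMatrix A μ P) (B : (Fin n → Fin n → ZMod p) → Prop) :
    P.real {ω | B (fun i j => A ω i j)} = pr (wt (wt fun x => (μ x).toReal)) B := by
  let X : Fin n × Fin n → Ω → ZMod p := fun ij ω => A ω ij.1 ij.2
  have hX : ∀ ij, AEMeasurable (X ij) P := fun ij => (h.law ij.1 ij.2).aemeasurable
  have hmap := (iIndepFun_iff_map_fun_eq_pi_map hX).1 h.indep
  have hlaw : ∀ ij, P.map (X ij) = μ.toMeasure := fun ij => (h.law ij.1 ij.2).map_eq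
  simp only [hlaw] at hmap
  have hX' : AEMeasurable (fun ω ij => X ij ω) P := aemeasurable_pi_lambda _ hX
  let S : Finset (Fin n × Fin n → ZMod p) := univ.filter fun x => B (fun i j => x (i, j))
  have h1 : P.real {ω | B (fun i j => A ω i j)} =
      (P.map (fun ω ij => X ij ω)).real (S : Set (Fin n × Fin n → ZMod p)) := by
    rw [measureReal_def, measureReal_def, Measure.map_apply_of_aemeasurable hX'
      (S.finite_toSet.measurableSet)]
    congr 2
    ext ω
    simp [S, X]
  rw [h1, hmap, ← sum_measureReal_singleton]
  have h2 : ∀ x : Fin n × Fin n → ZMod p, (Measure.pi fun _ => μ.toMeasure).real {x} =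
      wt (fun x => (μ x).toReal) x := fun x => by
    rw [measureReal_def, Measure.pi_singleton, ENNReal.toReal_prod, wt]
    exact prod_congr rfl fun i _ => by
      rw [PMF.toMeasure_apply_singleton _ _ (measurableSet_singleton _)]
  simp only [h2]
  have h3 := pr_curry (w := fun x => (μ x).toReal) (κ := Fin n) (ε := Fin n)
    (fun x : Fin n × Fin n → ZMod p => B (fun i j => x (i, j)))
  simp only [Function.uncurry_apply_pair] at h3
  refine Eq.trans ?_ h3
  rw [pr, ev, sum_filter]
  refine sum_congr rfl fun x _ => ?_
  split_ifs <;> simp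

end Transfer

/-! ### Numerical bounds for the limiting probabilities. -/

section Constants
open Finset

/-- The factor `1 - q ^ n` strengthens the induction: it leaves room `q ^ (e + n) * (1 - q)`, which
covers the new loss `q ^ (e + n + 1)` because `q ≤ 1 / 2`. -/
theorem one_sub_pow_mul_le_prod {q : ℝ} (h0 : 0 ≤ q) (h1 : q ≤ 1 / 2) (e n : ℕ) :
    1 - q ^ e * (1 - q ^ n) ≤ ∏ j ∈ range n, (1 - q ^ (e + j + 1)) := by
  have hpow : ∀ k, q ^ k ≤ 1 := fun k => pow_le_one₀ h0 (by linarith)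
  have hnn : ∀ k, 0 ≤ q ^ k := fun k => pow_nonneg h0 k
  induction n with
  | zero => simp
  | succ n ih =>
    rw [prod_range_succ]
    refine le_trans ?_ (mul_le_mul_of_nonneg_right ih (sub_nonneg.2 (hpow _)))
    have e1 : q ^ (e + n + 1) = q ^ e * q ^ n * q := by ring
    have e2 : q ^ (n + 1) = q ^ n * q := by ring
    rw [e1, e2]
    have h2 : 0 ≤ q ^ e * q ^ n * (1 - 2 * q) :=
      mul_nonneg (mul_nonneg (hnn e) (hnn n)) (by linarith)
    have h3 : 0 ≤ q ^ e * q ^ n * q * (q ^ e * (1 - q ^ n)) :=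
      mul_nonneg (mul_nonneg (mul_nonneg (hnn e) (hnn n)) h0)
        (mul_nonneg (hnn e) (sub_nonneg.2 (hpow n)))
    nlinarith

theorem inv_cast_le_third {p : ℕ} (hp : 3 ≤ p) : (p : ℝ)⁻¹ ≤ 1 / 3 := by
  have : (3 : ℝ) ≤ p := by exact_mod_cast hp
  rw [one_div]
  exact inv_anti₀ (by norm_num) this

variable {p : ℕ} [Fact p.Prime] {m : ZMod p → ℝ} {β ρ : ℝ}

/-- With $q = 1/p$, the step from degree 2 to degree 1 loses $q^2$, and the bonus of the triples,
$(q^2-q^3)(1-3q)$ to leading order, restores it. All other losses are of order $q^3$; the constant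
10 is generous. -/
theorem robustBound_one_of_cube (hm : IsNondeg m β ρ) (hp : 3 ≤ p) :
    RobustBound m 1 (1 - 10 * (p : ℝ)⁻¹ ^ 3) := by
  have hq3 := inv_cast_le_third hp
  have hq0 : (0 : ℝ) ≤ (p : ℝ)⁻¹ := by positivity
  have h3 : RobustBound m 3 (1 - (p : ℝ)⁻¹ ^ 3) := by
    refine robustBound_of_le_prod hm hp fun n => ?_
    simp only [← inv_pow]
    refine le_trans ?_ (one_sub_pow_mul_le_prod hq0 (by linarith) 3 n)
    have : 0 ≤ (p : ℝ)⁻¹ ^ 3 * (p : ℝ)⁻¹ ^ n := by positivity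
    linarith
  have hc : (((0 : ℕ) : ℝ) + 3) / ((((0 : ℕ) : ℝ) + 1) * p) = 3 * (p : ℝ)⁻¹ := by
    rw [div_eq_mul_inv]; simp
  have t2 := RobustBound.tripleBound hm (d := 0) h3 (by rw [hc]; linarith)
  have r1 := (h3.step hm hp).step_of_tripleBound hm hp t2
  refine r1.mono ?_
  rw [hc]
  simp only [← inv_pow]
  set q := (p : ℝ)⁻¹
  have hq3' : 0 ≤ q ^ 3 := by positivity
  have e1 : (1 - q ^ 3) * (1 - q ^ (2 + 1)) * (1 - q ^ (1 + 1)) +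
      (1 - q ^ 3) * (1 - 3 * q) * (q ^ (1 + 1) - q ^ (1 + 2)) - (1 - 10 * q ^ 3) =
      q ^ 3 * (4 + q * (3 + q + 5 * q ^ 2 - 3 * q ^ 3 - q ^ 4)) := by ring
  have e2 : 0 ≤ 3 + q + 5 * q ^ 2 - 3 * q ^ 3 - q ^ 4 := by
    have h1 : q ^ 3 ≤ 1 / 3 := by nlinarith [pow_le_one₀ (n := 2) hq0 (by linarith : q ≤ 1)]
    have h2 : q ^ 4 ≤ 1 := pow_le_one₀ hq0 (by linarith)
    nlinarith
  have e3 : 0 ≤ q ^ 3 * (4 + q * (3 + q + 5 * q ^ 2 - 3 * q ^ 3 - q ^ 4)) := by positivity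
  linarith

theorem alphaConst_lt_one_and_forall_le (hp : 3 ≤ p) :
    0 < 1 - alphaConst p ∧
      ∀ n, 1 - alphaConst p ≤ ∏ j ∈ range n, (1 - ((p : ℝ) ^ (j + 1))⁻¹) := by
  have hq3 := inv_cast_le_third hp
  have hq0 : (0 : ℝ) ≤ (p : ℝ)⁻¹ := by positivity
  have hlim := (alphaConst_multipliable p (by omega)).hasProd.tendsto_prod_nat
  have hα : 1 - alphaConst p = ∏' i : ℕ, (1 - ((p : ℝ) ^ (i + 1))⁻¹) := by
    rw [alphaConst, sub_sub_cancel]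
  have hnn : ∀ j : ℕ, (0 : ℝ) ≤ 1 - ((p : ℝ) ^ (j + 1))⁻¹ := fun j =>
    sub_nonneg.2 (inv_pow_le_one _)
  have hle : ∀ j : ℕ, 1 - ((p : ℝ) ^ (j + 1))⁻¹ ≤ 1 := fun j => sub_le_self _ (by positivity)
  have hanti : Antitone fun n => ∏ j ∈ range n, (1 - ((p : ℝ) ^ (j + 1))⁻¹) :=
    antitone_nat_of_succ_le fun n => by
      rw [prod_range_succ]
      exact mul_le_of_le_one_right (prod_nonneg fun j _ => hnn j) (hle n)
  rw [hα]
  refine ⟨?_, fun n => hanti.le_of_tendsto hlim n⟩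
  -- The first factor is split off; the remaining ones have product at least `1 - p⁻¹`.
  have h1 : ∀ n, (1 - (p : ℝ)⁻¹) * (1 - (p : ℝ)⁻¹) ≤
      ∏ j ∈ range (n + 1), (1 - ((p : ℝ) ^ (j + 1))⁻¹) := fun n => by
    rw [prod_range_succ']
    simp only [← inv_pow, zero_add, pow_one]
    refine mul_le_mul_of_nonneg_right ?_ (by linarith)
    have := one_sub_pow_mul_le_prod hq0 (by linarith) 1 n
    simp only [add_comm 1, pow_one] at this
    refine le_trans ?_ this
    have : 0 ≤ (p : ℝ)⁻¹ * (p : ℝ)⁻¹ ^ n := by positivity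
    linarith
  have h2 := ge_of_tendsto' (hlim.comp (tendsto_add_atTop_nat 1)) h1
  have h3 : 0 < (1 - (p : ℝ)⁻¹) * (1 - (p : ℝ)⁻¹) := by
    have : 0 < 1 - (p : ℝ)⁻¹ := by linarith
    positivity
  linarith

/-- A constant by which the limiting probabilities are separated from `alphaConst p`. -/
theorem exists_robustBound_one (hp : 3 ≤ p) :
    ∃ δ > 0, ∀ {m : ZMod p → ℝ} {β ρ : ℝ}, IsNondeg m β ρ →
      ∃ x, RobustBound m 1 x ∧ 1 - x * (1 - 1 / p) = alphaConst p - δ := by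
  have hq3 := inv_cast_le_third hp
  have hq0 : (0 : ℝ) < (p : ℝ)⁻¹ := by
    have : (0 : ℝ) < p := by exact_mod_cast (NeZero.pos p)
    positivity
  obtain ⟨hQ0, hQ⟩ := alphaConst_lt_one_and_forall_le (p := p) hp
  simp only [← inv_pow] at hQ
  set q := (p : ℝ)⁻¹ with hq
  set Q := 1 - alphaConst p with hQdef
  have hpos : ∀ k, 0 < k → 0 < 1 - q ^ k := fun k hk =>
    sub_pos.2 (pow_lt_one₀ hq0.le (by linarith) hk.ne')
  have a1 := hpos 1 (by norm_num)
  have a2 := hpos 2 (by norm_num)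
  have a3 := hpos 3 (by norm_num)
  have a4 := hpos 4 (by norm_num)
  -- This is the tail of the infinite product from exponent 5 on, the bound for degree 4.
  set x₄ := Q / ((1 - q ^ 1) * (1 - q ^ 2) * (1 - q ^ 3) * (1 - q ^ 4)) with hx₄
  have hx₄0 : 0 < x₄ := by positivity
  have hq34 : 0 < q ^ 3 - q ^ 4 := by
    have : q ^ 3 - q ^ 4 = q ^ 3 * (1 - q ^ 1) := by ring
    rw [this]; positivity
  have h2q : 0 < 1 - 2 * q := by linarith
  -- The bonus of the triples in degree 3, carried down through the last steps. In degree 2 the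
  -- factor would be `1 - 3 * q`, which vanishes for `p = 3`; in degree 3 it is `1 - 2 * q > 0`.
  refine ⟨x₄ * (1 - 2 * q) * (q ^ 3 - q ^ 4) * (1 - q ^ 2) * (1 - q ^ 1), by positivity,
    fun {m β ρ} hm => ?_⟩
  have h4 : RobustBound m 4 x₄ := by
    refine robustBound_of_le_prod hm hp fun n => ?_
    simp only [← inv_pow]
    rw [hx₄, div_le_iff₀ (by positivity), mul_comm]
    refine (hQ (4 + n)).trans_eq ?_
    rw [prod_range_add]
    congr 1
    simp [prod_range_succ]
  have hc : (((1 : ℕ) : ℝ) + 3) / ((((1 : ℕ) : ℝ) + 1) * p) = 2 * q := by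
    rw [hq, div_eq_mul_inv, mul_inv]; push_cast; ring
  have t3 := RobustBound.tripleBound hm (d := 1) h4 (by rw [hc]; linarith)
  have r1 := ((h4.step hm hp).step_of_tripleBound hm hp t3).step hm hp
  refine ⟨_, r1, ?_⟩
  rw [hc, one_div]
  simp only [← inv_pow, ← hq]
  have e1 : x₄ * ((1 - q ^ 1) * (1 - q ^ 2) * (1 - q ^ 3) * (1 - q ^ 4)) = Q := by
    rw [hx₄]
    exact div_mul_cancel₀ _ (by positivity)
  have e2 : alphaConst p = 1 - Q := by rw [hQdef]; ring
  rw [e2, ← e1]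
  ring

end Constants

/-! ### Passage to the upper and lower limits. -/

theorem theorem1p4 :
    ∃ C : ℝ, ∀ (p : ℕ) [Fact p.Prime], 3 ≤ p →
      ∃ δ : ℝ, 0 < δ ∧
        ∀ μ : PMF (ZMod p), μ.support.Nontrivial →
        ∀ (Ω : ℕ → Type*) [∀ n, MeasurableSpace (Ω n)]
          (P : ∀ n, Measure (Ω n)) [∀ n, IsProbabilityMeasure (P n)]
          (A : ∀ n, Ω n → Matrix (Fin n) (Fin n) (ZMod p)),
          (∀ n, IsIIDMatrix (A n) μ (P n)) →
        ∀ z : ZMod p,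
          limsup (fun n => (P n).real {ω | (A n ω).permanent = z}) atTop ≤ alphaConst p - δ ∧
          1 / (p : ℝ) - C / (p : ℝ) ^ 3 ≤
            liminf (fun n => (P n).real {ω | (A n ω).permanent = z}) atTop ∧
          liminf (fun n => (P n).real {ω | (A n ω).permanent = z}) atTop ≤
            limsup (fun n => (P n).real {ω | (A n ω).permanent = z}) atTop ∧
          limsup (fun n => (P n).real {ω | (A n ω).permanent = z}) atTop ≤
            1 / (p : ℝ) + C / (p : ℝ) ^ 3 := by
  refine ⟨10, fun p _ hp => ?_⟩
  obtain ⟨δ, hδ, hx⟩ := exists_robustBound_one (p := p) hp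
  refine ⟨δ, hδ, fun μ hμ Ω _ P _ A hA z => ?_⟩
  obtain ⟨β, ρ, hm⟩ := exists_isNondeg μ hμ
  obtain ⟨x, hx, hxα⟩ := hx hm
  have hcube := robustBound_one_of_cube hm hp
  set u : ℕ → ℝ := fun n => (P n).real {ω | (A n ω).permanent = z} with hu
  have hpr : ∀ n, u n = pr (wt (wt fun x => (μ x).toReal))
      (fun M : Fin n → Fin n → ZMod p => Matrix.permanent (Matrix.of M) = z) := fun n =>
    measureReal_eq_pr (hA n) (fun M => Matrix.permanent (Matrix.of M) = z)
  have hbdd : IsBoundedUnder (· ≤ ·) atTop u :=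
    isBoundedUnder_of ⟨1, fun n => measureReal_le_one⟩
  have hbdd' : IsBoundedUnder (· ≥ ·) atTop u :=
    isBoundedUnder_of ⟨0, fun n => measureReal_nonneg⟩
  have hsup : ∀ b : ℝ, (∀ ε > 0, ∃ n₀, ∀ n ≥ n₀, u n ≤ b + ε) → limsup u atTop ≤ b :=
    fun b hb => le_of_forall_pos_le_add fun ε hε =>
      limsup_le_of_le hbdd'.isCoboundedUnder_le (eventually_atTop.2 (hb ε hε))
  have hq3 := inv_cast_le_third hp
  have hq0 : (0 : ℝ) ≤ (p : ℝ)⁻¹ := by positivity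
  have hq0' : (0 : ℝ) ≤ (p : ℝ)⁻¹ ^ 3 := by positivity
  have hC : (10 : ℝ) / (p : ℝ) ^ 3 = 10 * (p : ℝ)⁻¹ ^ 3 := by rw [div_eq_mul_inv, inv_pow]
  rw [hC, one_div]
  refine ⟨hsup _ fun ε hε => ?_, le_of_forall_pos_sub_le fun ε hε =>
    le_liminf_of_le hbdd.isCoboundedUnder_ge (eventually_atTop.2 ?_),
    liminf_le_limsup hbdd hbdd', hsup _ fun ε hε => ?_⟩
  · obtain ⟨n₀, hn₀⟩ := hx.permanent hm hε
    exact ⟨n₀, fun n hn => by rw [hpr, ← hxα]; exact (hn₀ n hn z).2⟩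
  · obtain ⟨n₀, hn₀⟩ := hcube.permanent hm hε
    refine ⟨n₀, fun n hn => ?_⟩
    rw [hpr]
    refine le_trans ?_ (hn₀ n hn z).1
    rw [div_eq_mul_inv]
    nlinarith
  · obtain ⟨n₀, hn₀⟩ := hcube.permanent hm hε
    refine ⟨n₀, fun n hn => ?_⟩
    rw [hpr]
    refine (hn₀ n hn z).2.trans ?_
    rw [one_div]
    nlinarith
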